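/- Let $v\ge 0$ be real. For $s=(s_1,\dots,s_k)\in\mathbb C^k$ let $$\zeta(s_1,\dots,s_k;v)=\operatorname*{fp}_{N\to\infty}\ \sum_{0<n_k<\cdots<n_1\le N}(n_1+v)^{-s_1}\cdots(n_k+v)^{-s_k},$$ where $\operatorname{fp}_{N\to\infty}$ is the constant term of the asymptotic expansion in terms $N^{\beta}\log^l N$ ($\beta\in\mathbb C$, $l\in\mathbb N$); for generic $s$ this is the meromorphic continuation of the Hurwitz multiple zeta function. Put $$\zeta^{\rm alt}(s_1,\dots,s_k;v)=\lim_{z\to0,\ z\neq0}\zeta(s_1+z,\dots,s_k+z;v).$$ Let $\gamma$ be holomorphic near $0\in\mathbb C$ with $\gamma(0)=0$, $\gamma'(0)=1$. Write $\sigma_s(n)=(n+v)^{-s}$ for integers $n\ge1$, and let $\mathcal R(\tau)(z)(n)=\tau(n)(n+v)^{-\gamma(z)}$ and $\widetilde{\mathcal R}(\tau_1\otimes\cdots\otimes\tau_k)(z)=\mathcal R(\tau_1)(z)\otimes\cdots\otimes\mathcal R(\tau_k)(z)$. For a composition $I=(i_1,\dots,i_k)$ of $n$ let $I[u_1\otimes\cdots\otimes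 u_n]$ be the tensor of length $k$ obtained by multiplying the factors inside consecutive blocks of sizes $i_1,\dots,i_k$; let $\exp u=\sum_I\frac1{i_1!\cdots i_k!}I[u]$ and $\log u=\sum_I\frac{(-1)^{n-k}}{i_1\cdots i_k}I[u]$ (Hoffman's isomorphisms), and $\widetilde{\mathcal R}^\star=\exp\circ\widetilde{\mathcal R}\circ\log$. Let $\Psi(w)(z)$ be the finite part as $N\to\infty$ of the strict nested sum, truncated at $n_1\le N$ and extended linearly, of $\widetilde{\mathcal R}^\star(w)(z)$. With $\pi$ the projection of Laurent series at $z=0$ onto their pole part, define recursively $\overline\Psi(w)=\Psi(w)+\sum_{w=w'w''}\Psi_-(w')\Psi(w'')$ (sum over splittings into nonempty words), $\Psi_-(w)=-\pi\overline\Psi(w)$, $\Psi_+(w)=(1-\pi)\overline\Psi(w)$. The renormalised (stuffle-compatible) Hurwitz multiple zeta value is the value of $\Psi_+(\sigma_{s_1}\otimes\cdots\otimes\sigma_{s_k})$ at $z=0$; denote it by $\zeta^{\rm ren}(s_1,\dots,s_k;v)$. Then for all integers $a_1,a_2\ge0$ and all such $\gamma$, for the arguments $(-a_1)$ and $(-a_1,-a_2)$,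 the finite parts above exist for all $z\ne0$ near $0$, the function $\Psi(\sigma_{-a_1})$, resp. $\Psi(\sigma_{-a_1}\otimes\sigma_{-a_2})$, is meromorphic at $0$, the value of $\Psi_+$ at $0$ and the limit defining $\zeta^{\rm alt}$ exist, and $$\zeta^{\rm ren}(-a_1;v)=\zeta^{\rm alt}(-a_1;v),\qquad \zeta^{\rm ren}(-a_1,-a_2;v)=\zeta^{\rm alt}(-a_1,-a_2;v).$$ -/

import Mathlib

open Filter Topology

namespace HurwitzMZV

noncomputable section

/-! ### Finite parts and cut-off nested sums -/

/-- `HasFinitePart f C`: as `N → ∞`, `f N` has an asymptotic expansion (up to `o(1)`) in terms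
`N ^ β * (log N) ^ l`, `β ∈ ℂ`, `l ∈ ℕ`, whose constant term, i.e. the coefficient of
`N ^ 0 * (log N) ^ 0`, is `C`. -/
def HasFinitePart (f : ℕ → ℂ) (C : ℂ) : Prop :=
  ∃ (E : Finset (ℂ × ℕ)) (c : ℂ × ℕ → ℂ), (0, 0) ∉ E ∧
    Tendsto (fun N : ℕ => f N - ∑ e ∈ E, c e * (N : ℂ) ^ e.1 * (Real.log N : ℂ) ^ e.2)
      atTop (𝓝 C)

open Classical in
/-- The finite part (constant term) of `f N` as `N → ∞`. -/
def finitePart (f : ℕ → ℂ) : ℂ :=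
  if h : ∃ C, HasFinitePart f C then h.choose else 0

/-- A symbol enters nested sums only through its values at the positive integers; it is
represented by that sequence. The product of symbols is the pointwise product. -/
abbrev Sym : Type := ℕ → ℂ

/-- The truncated nested sum
`∑_{0 < n_k < ⋯ < n_1 ≤ N} σ_1(n_1) ⋯ σ_k(n_k)` of `σ_1 ⊗ ⋯ ⊗ σ_k`. -/
def nestedSum : List Sym → ℕ → ℂ
  | [], _ => 1
  | σ :: w, N => ∑ n ∈ Finset.Icc 1 N, σ n * nestedSum w (n - 1)

/-- Formal linear combinations of pure tensors `σ_1 ⊗ ⋯ ⊗ σ_k`, written as lists. All the maps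
below are multilinear in the tensor factors, so they are computed on such representatives of the
elements of the tensor algebra. -/
abbrev Tensors : Type := List Sym →₀ ℂ

/-- The truncated nested sum, extended linearly. -/
def truncatedSum (x : Tensors) (N : ℕ) : ℂ :=
  x.sum fun w c => c * nestedSum w N

/-- The cut-off nested sum (strict inequalities): the finite part of the truncated sums. -/
def cutoffSum (x : Tensors) : ℂ :=
  finitePart (truncatedSum x)

/-! ### The Hoffman isomorphism and the twisted regularisation -/

/-- `I[u] = (v_1 ⋯ v_{i_1}) ⊗ (v_{i_1+1} ⋯ v_{i_1+i_2}) ⊗ ⋯` for a composition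
`I = (i_1, …, i_k)` of `n` and `u = v_1 ⊗ ⋯ ⊗ v_n`. -/
def contract {n : ℕ} (I : Composition n) (u : List Sym) : List Sym :=
  (u.splitWrtComposition I).map List.prod

/-- Hoffman's `exp u = ∑_I (i_1! ⋯ i_k!)⁻¹ I[u]`. -/
def hoffmanExp : Tensors →ₗ[ℂ] Tensors :=
  Finsupp.linearCombination ℂ fun u : List Sym =>
    ∑ I : Composition u.length,
      Finsupp.single (contract I u) ((I.blocks.map fun i => ((i.factorial : ℂ))⁻¹).prod)

/-- Hoffman's `log u = ∑_I (-1)^(n-k) (i_1 ⋯ i_k)⁻¹ I[u]`. -/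
def hoffmanLog : Tensors →ₗ[ℂ] Tensors :=
  Finsupp.linearCombination ℂ fun u : List Sym =>
    ∑ I : Composition u.length,
      Finsupp.single (contract I u)
        ((-1) ^ (u.length - I.length) * (I.blocks.map fun i => ((i : ℂ))⁻¹).prod)

/-- The extension `σ_1 ⊗ ⋯ ⊗ σ_k ↦ R(σ_1) ⊗ ⋯ ⊗ R(σ_k)`, linear on tensors. -/
def tensorExt (R : Sym → Sym) : Tensors →ₗ[ℂ] Tensors :=
  Finsupp.lmapDomain ℂ ℂ (List.map R)

/-- The twisted regularisation `exp ∘ (tensor extension of R) ∘ log`. -/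
def twistedReg (R : Sym → Sym) : Tensors →ₗ[ℂ] Tensors :=
  hoffmanExp ∘ₗ tensorExt R ∘ₗ hoffmanLog

/-! ### Hurwitz symbols, the shifted Riesz regularisation and the meromorphic character -/

/-- The symbol `σ_s^v(n) = (n + v)^(-s)`, `n ≥ 1`, vanishing at `0`. -/
def hurwitzSym (v : ℝ) (s : ℂ) : Sym :=
  fun n => if n = 0 then 0 else ((n : ℂ) + (v : ℂ)) ^ (-s)

/-- The regularisation `R_v(τ)(z)(n) = τ(n) (n + v)^(-γ(z))`. -/
def riesz (v : ℝ) (γ : ℂ → ℂ) (z : ℂ) (τ : Sym) : Sym :=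
  fun n => τ n * ((n : ℂ) + (v : ℂ)) ^ (-(γ z))

/-- The twisted regularisation of `σ_{s_1}^v ⊗ ⋯ ⊗ σ_{s_k}^v` at the parameter `z`. -/
def regularised (v : ℝ) (γ : ℂ → ℂ) (w : List Sym) (z : ℂ) : Tensors :=
  twistedReg (riesz v γ z) (Finsupp.single w 1)

/-- The character `Ψ`: `z ↦` cut-off nested sum of the twisted regularisation at `z`. -/
def Psi (v : ℝ) (γ : ℂ → ℂ) (w : List Sym) (z : ℂ) : ℂ :=
  cutoffSum (regularised v γ w z)

/-! ### Birkhoff factorisation (minimal subtraction, deconcatenation coproduct) -/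

/-- `p(1/z)` is the pole part at `0` of the meromorphic germ `f`. -/
def IsPolePart (f : ℂ → ℂ) (p : Polynomial ℂ) : Prop :=
  p.coeff 0 = 0 ∧ ∃ g : ℂ → ℂ, AnalyticAt ℂ g 0 ∧ ∀ᶠ z in 𝓝[≠] (0 : ℂ), f z = p.eval z⁻¹ + g z

open Classical in
/-- The projection `π` of a meromorphic germ at `0` onto its pole part in `z⁻¹ ℂ[z⁻¹]`. -/
def polePart (f : ℂ → ℂ) : ℂ → ℂ :=
  if h : ∃ p, IsPolePart f p then fun z => h.choose.eval z⁻¹ else 0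

/-- The counterterm `Φ₋` of the Birkhoff factorisation of `Φ`: `Φ₋(1) = 1` and, for a nonempty
word `w`, `Φ₋(w) = -π (Φ(w) + ∑ Φ₋(w') Φ(w''))`, the sum being over the splittings `w = w' w''`
into nonempty words. The term of index `j = 0` below is `Φ(w)`. -/
def birkhoffMinus (Φ : List Sym → ℂ → ℂ) (w : List Sym) : ℂ → ℂ :=
  if w = [] then 1 else
    -polePart fun z => ∑ j : Fin w.length, birkhoffMinus Φ (w.take j) z * Φ (w.drop j) z
termination_by w.length
decreasing_by simp

/-- The regular factor `Φ₊`: `Φ₊(1) = 1` and, for a nonempty word `w`,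
`Φ₊(w) = (1 - π) (Φ(w) + ∑ Φ₋(w') Φ(w''))`. -/
def birkhoffPlus (Φ : List Sym → ℂ → ℂ) (w : List Sym) : ℂ → ℂ :=
  if w = [] then 1 else
    (fun z => ∑ j : Fin w.length, birkhoffMinus Φ (w.take j) z * Φ (w.drop j) z) -
      polePart fun z => ∑ j : Fin w.length, birkhoffMinus Φ (w.take j) z * Φ (w.drop j) z

/-! ### The two families of values -/

/-- The pure tensor `σ_{s_1}^v ⊗ ⋯ ⊗ σ_{s_k}^v`. -/
def word (v : ℝ) (s : List ℂ) : List Sym :=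
  s.map (hurwitzSym v)

/-- The Hurwitz multiple zeta function `ζ(s_1, …, s_k; v)`, extended by cut-off nested sums. -/
def zeta (v : ℝ) (s : List ℂ) : ℂ :=
  cutoffSum (Finsupp.single (word v s) 1)

/-- The renormalised value at `(s_1, …, s_k)`: the value at `z = 0` of the regular factor `Ψ₊`
of the Birkhoff factorisation (singularity at `0` removed). -/
def renormalisedZeta (v : ℝ) (γ : ℂ → ℂ) (s : List ℂ) : ℂ :=
  limUnder (𝓝[≠] (0 : ℂ)) (birkhoffPlus (Psi v γ) (word v s))

/-- `ζ^alt(s_1, …, s_k; v) = lim_{z → 0} ζ(s_1 + z, …, s_k + z; v)`. -/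
def altZeta (v : ℝ) (s : List ℂ) : ℂ :=
  limUnder (𝓝[≠] (0 : ℂ)) fun z => zeta v (s.map (· + z))

/-- The renormalised value really exists: the finite parts defining `Ψ` exist near `z = 0`,
`Ψ` is meromorphic at `0`, and `Ψ₊` has a limit at `0`. -/
structure RenormalisedZetaExists (v : ℝ) (γ : ℂ → ℂ) (s : List ℂ) : Prop where
  finitePart : ∀ᶠ z in 𝓝[≠] (0 : ℂ),
    HasFinitePart (truncatedSum (regularised v γ (word v s) z)) (Psi v γ (word v s) z)
  meromorphic : MeromorphicAt (Psi v γ (word v s)) 0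
  tendsto : Tendsto (birkhoffPlus (Psi v γ) (word v s)) (𝓝[≠] 0) (𝓝 (renormalisedZeta v γ s))

/-- The value `ζ^alt` really exists: the finite parts defining `ζ(s_1 + z, …, s_k + z; v)` exist
near `z = 0`, and so does the limit as `z → 0`. -/
structure AltZetaExists (v : ℝ) (s : List ℂ) : Prop where
  finitePart : ∀ᶠ z in 𝓝[≠] (0 : ℂ),
    HasFinitePart (nestedSum (word v (s.map (· + z)))) (zeta v (s.map (· + z)))
  tendsto : Tendsto (fun z => zeta v (s.map (· + z))) (𝓝[≠] 0) (𝓝 (altZeta v s))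

end

end HurwitzMZV

/-! In depths one and two nothing has to be subtracted: `Psi` is already regular at `z = 0`, so
every counterterm vanishes and the renormalised value is the limit of `Psi`. In depth one, `Psi` is
the Hurwitz zeta function at `-a + γ z`. Its only pole is at `1`, so the limit is its value at `-a`,
whatever `γ` is.

In depth two the twist adds only the defect of multiplicativity of the regularisation, and `Psi` is
`ζ(-a + γ z, -b + γ z) + ½ ζ(-a - b + 2 γ z) - ½ ζ(-a - b + γ z)`. The last two terms cancel at `z =
0`. The point `(-a + γ z, -b + γ z)` stays on the diagonal line used by `altZeta`, so only
regularity along that line is needed.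

This regularity is `exists_analyticAt_zetaCont₂`. Euler–Maclaurin for the inner sum
(`one_sub_mul_hurwitzSum`, inserted in `one_sub_mul_hurwitzSum₂`) writes `(1 - t) ζ(s, t)` as `∑
emCoeff j t * ζ(s + t + j - 1)`, plus a product of one-variable functions and a convergent series,
both regular at the point. Only `j = a + b + 2` meets the pole of `ζ`, and there the coefficient has
a factor vanishing at `t = -b`: a simple zero along the diagonal against a simple pole.

Finite parts are identified with these continuations because, for nonintegral exponents, the
expansions of the powers `(N + c) ^ β` have no constant term. The choice hidden in `finitePart` is
harmless by `HasFinitePart.unique`, the asymptotic independence of the functions `N ^ β (log N) ^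
l`. -/

namespace HurwitzMZV

/-! ### The binomial series with remainder -/

/-- The generalised binomial coefficient `β (β - 1) ⋯ (β - k + 1) / k!`. -/
noncomputable def binom (β : ℂ) (k : ℕ) : ℂ :=
  (∏ i ∈ Finset.range k, (β - i)) / k.factorial

/-- The remainder of order `K` of the binomial series of `(1 + t) ^ β`. -/
noncomputable def binomRem (K : ℕ) (β : ℂ) (t : ℝ) : ℂ :=
  ((1 + t : ℝ) : ℂ) ^ β - ∑ k ∈ Finset.range K, binom β k * (t : ℂ) ^ k

lemma succ_mul_binom (β : ℂ) (k : ℕ) :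
    ((k : ℂ) + 1) * binom β (k + 1) = β * binom (β - 1) k := by
  have h1 : ((k.factorial : ℕ) : ℂ) ≠ 0 := by exact_mod_cast k.factorial_ne_zero
  have h2 : ((k : ℂ) + 1) ≠ 0 := by exact_mod_cast k.succ_ne_zero
  unfold binom
  rw [Finset.prod_range_succ', Nat.factorial_succ]
  have : ∏ i ∈ Finset.range k, (β - ((i + 1 : ℕ) : ℂ)) = ∏ i ∈ Finset.range k, (β - 1 - i) := by
    refine Finset.prod_congr rfl fun i _ => ?_
    push_cast
    ring
  rw [this]
  push_cast
  field_simp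
  ring

lemma hasDerivAt_binomRem (K : ℕ) (β : ℂ) {t : ℝ} (ht : 0 ≤ t) :
    HasDerivAt (binomRem (K + 1) β) (β * binomRem K (β - 1) t) t := by
  have h1 : HasDerivAt (fun t : ℝ => ((1 + t : ℝ) : ℂ) ^ β) (β * ((1 + t : ℝ) : ℂ) ^ (β - 1)) t := by
    have h0 : HasDerivAt (fun w : ℂ => (1 + w) ^ β) (β * (1 + (t : ℂ)) ^ (β - 1)) t := by
      have hs : 1 + (t : ℂ) ∈ Complex.slitPlane := Or.inl (by simp; linarith)
      simpa using ((hasDerivAt_id (t : ℂ)).const_add 1).cpow_const (c := β) hs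
    simpa using h0.comp_ofReal
  have h2 : ∀ k ∈ Finset.range K, HasDerivAt (fun t : ℝ => binom β (k + 1) * (t : ℂ) ^ (k + 1))
      (β * (binom (β - 1) k * (t : ℂ) ^ k)) t := by
    intro k _
    have h := (((hasDerivAt_id t).ofReal_comp).pow (k + 1)).const_mul (binom β (k + 1))
    refine h.congr_deriv ?_
    have := succ_mul_binom β k
    simp only [id, Nat.add_sub_cancel, Complex.ofReal_one, mul_one]
    push_cast
    linear_combination (t : ℂ) ^ k * this
  have h3 := h1.sub ((HasDerivAt.fun_sum h2).add_const (binom β 0))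
  refine (h3.congr_deriv ?_).congr_of_eventuallyEq (Eventually.of_forall fun u => ?_)
  · rw [binomRem, mul_sub, Finset.mul_sum]
  · simp [binomRem, Finset.sum_range_succ' _ K]

lemma binomRem_zero (K : ℕ) (β : ℂ) : binomRem (K + 1) β 0 = 0 := by
  simp [binomRem, Finset.sum_range_succ', binom]

/-- Differentiation lowers the order of the remainder by one and replaces `β` by `β - 1`, and
remainders of positive order vanish at `0`; the mean value inequality then gains one power of `t`
per step. Uniformity in `β` makes the later bounds locally uniform in `s`. -/
theorem exists_norm_binomRem_le (K : ℕ) (B : ℝ) :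
    ∃ C, 0 ≤ C ∧ ∀ β : ℂ, ‖β‖ ≤ B → ∀ t ∈ Set.Icc (0 : ℝ) 1, ‖binomRem K β t‖ ≤ C * t ^ K := by
  induction K generalizing B with
  | zero =>
    refine ⟨2 ^ B, by positivity, fun β hβ t ht => ?_⟩
    have h1 : (1 : ℝ) ≤ 1 + t := by linarith [ht.1]
    simp only [binomRem, Finset.range_zero, Finset.sum_empty, sub_zero, pow_zero, mul_one]
    rw [Complex.norm_cpow_eq_rpow_re_of_pos (by linarith)]
    have hB : β.re ≤ B := (Complex.re_le_norm β).trans hβ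
    have hB0 : 0 ≤ B := (norm_nonneg β).trans hβ
    calc (1 + t) ^ β.re ≤ (1 + t) ^ B := Real.rpow_le_rpow_of_exponent_le h1 hB
      _ ≤ 2 ^ B := Real.rpow_le_rpow (by linarith) (by linarith [ht.2]) hB0
  | succ K ih =>
    obtain ⟨C, hC, h⟩ := ih (B + 1)
    refine ⟨|B| * C, by positivity, fun β hβ t ht => ?_⟩
    have hβ' : ‖β - 1‖ ≤ B + 1 := (norm_sub_le _ _).trans (by simpa using hβ)
    have key := (convex_Icc (0 : ℝ) t).norm_image_sub_le_of_norm_hasDerivWithin_le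
      (f := binomRem (K + 1) β) (f' := fun u => β * binomRem K (β - 1) u) (C := |B| * C * t ^ K)
      (x := 0) (y := t)
      (fun u hu => (hasDerivAt_binomRem K β hu.1).hasDerivWithinAt)
      (fun u hu => ?_) ⟨le_rfl, ht.1⟩ ⟨ht.1, le_rfl⟩
    · rw [binomRem_zero, sub_zero, sub_zero, Real.norm_of_nonneg ht.1] at key
      rw [pow_succ, ← mul_assoc]
      exact key
    · rw [norm_mul, mul_assoc]
      have h2 := h (β - 1) hβ' u ⟨hu.1, hu.2.trans ht.2⟩
      have h3 : u ^ K ≤ t ^ K := pow_le_pow_left₀ hu.1 hu.2 K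
      exact mul_le_mul (hβ.trans (le_abs_self B)) (h2.trans (by gcongr)) (norm_nonneg _)
        (abs_nonneg B)

/-- The binomial expansion of `(x + c) ^ β` for `0 ≤ c ≤ x`. -/
lemma cpow_add_eq {x c : ℝ} (hx : 0 < x) (hc : 0 ≤ c) (β : ℂ) (K : ℕ) :
    ((x + c : ℝ) : ℂ) ^ β =
      (∑ k ∈ Finset.range K, binom β k * (c : ℂ) ^ k * (x : ℂ) ^ (β - k)) +
        (x : ℂ) ^ β * binomRem K β (c / x) := by
  have hx' : (x : ℂ) ≠ 0 := by exact_mod_cast hx.ne'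
  have h1 : x + c = x * (1 + c / x) := by field_simp
  have h2 : (0 : ℝ) ≤ 1 + c / x := by positivity
  rw [h1, Complex.ofReal_mul, Complex.mul_cpow_ofReal_nonneg hx.le h2, binomRem, mul_sub,
    Finset.mul_sum, ← sub_eq_iff_eq_add', sub_right_inj]
  refine Finset.sum_congr rfl fun k _ => ?_
  rw [Complex.cpow_sub _ _ hx', Complex.cpow_natCast]
  push_cast
  rw [div_pow]
  ring

/-! ### Finite parts: linearity and uniqueness -/

/-- The combination `∑ c (β, l) N ^ β (log N) ^ l`. -/
noncomputable def powerLog (c : ℂ × ℕ →₀ ℂ) (N : ℕ) : ℂ :=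
  c.sum fun e a => a * (N : ℂ) ^ e.1 * (Real.log N : ℂ) ^ e.2

/-- Finitely supported coefficients can be added and scaled without merging two index sets, which
gives linearity of finite parts. -/
lemma hasFinitePart_iff {f : ℕ → ℂ} {C : ℂ} :
    HasFinitePart f C ↔ ∃ c : ℂ × ℕ →₀ ℂ, c (0, 0) = 0 ∧
      Tendsto (fun N => f N - powerLog c N) atTop (𝓝 C) := by
  classical
  constructor
  · rintro ⟨E, c, h0, h⟩
    refine ⟨Finsupp.onFinset E (fun e => if e ∈ E then c e else 0) (by aesop), by simp [h0], ?_⟩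
    refine h.congr fun N => ?_
    rw [powerLog, Finsupp.onFinset_sum _ (by simp)]
    congr 1
    exact Finset.sum_congr rfl fun e he => by simp [he]
  · rintro ⟨c, h0, h⟩
    exact ⟨c.support, c, by simpa using h0, h⟩

lemma powerLog_add (c d : ℂ × ℕ →₀ ℂ) (N : ℕ) :
    powerLog (c + d) N = powerLog c N + powerLog d N :=
  Finsupp.sum_add_index' (by simp) (by intros; ring)

lemma powerLog_smul (a : ℂ) (c : ℂ × ℕ →₀ ℂ) (N : ℕ) :
    powerLog (a • c) N = a * powerLog c N := by
  rw [powerLog, Finsupp.sum_smul_index (by simp), powerLog, Finsupp.mul_sum]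
  exact Finsupp.sum_congr fun e _ => by ring

lemma HasFinitePart.add {f g : ℕ → ℂ} {C D : ℂ} (hf : HasFinitePart f C)
    (hg : HasFinitePart g D) : HasFinitePart (fun N => f N + g N) (C + D) := by
  rw [hasFinitePart_iff] at *
  obtain ⟨c, hc, hc'⟩ := hf
  obtain ⟨d, hd, hd'⟩ := hg
  refine ⟨c + d, by simp [hc, hd], (hc'.add hd').congr fun N => ?_⟩
  rw [powerLog_add]
  ring

lemma HasFinitePart.const_mul {f : ℕ → ℂ} {C : ℂ} (a : ℂ) (hf : HasFinitePart f C) :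
    HasFinitePart (fun N => a * f N) (a * C) := by
  rw [hasFinitePart_iff] at *
  obtain ⟨c, hc, hc'⟩ := hf
  refine ⟨a • c, by simp [hc], (hc'.const_mul a).congr fun N => ?_⟩
  rw [powerLog_smul]
  ring

lemma hasFinitePart_of_tendsto {f : ℕ → ℂ} {C : ℂ} (h : Tendsto f atTop (𝓝 C)) :
    HasFinitePart f C :=
  ⟨∅, 0, by simp, by simpa using h⟩

lemma HasFinitePart.sum {ι : Type*} {s : Finset ι} {f : ι → ℕ → ℂ} {C : ι → ℂ}
    (h : ∀ i ∈ s, HasFinitePart (f i) (C i)) :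
    HasFinitePart (fun N => ∑ i ∈ s, f i N) (∑ i ∈ s, C i) := by
  classical
  induction s using Finset.induction_on with
  | empty => simpa using hasFinitePart_of_tendsto (tendsto_const_nhds (x := (0 : ℂ)))
  | insert i s hi ih =>
    simp only [Finset.sum_insert hi]
    exact (h i (by simp)).add (ih fun j hj => h j (by simp [hj]))

lemma HasFinitePart.congr' {f g : ℕ → ℂ} {C : ℂ} (hf : HasFinitePart f C)
    (h : f =ᶠ[atTop] g) : HasFinitePart g C := by
  obtain ⟨E, c, h0, h1⟩ := hf
  refine ⟨E, c, h0, h1.congr' ?_⟩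
  filter_upwards [h] with N hN
  rw [hN]

lemma hasFinitePart_natCast_cpow {β : ℂ} (hβ : β ≠ 0) :
    HasFinitePart (fun N => (N : ℂ) ^ β) 0 :=
  ⟨{(β, 0)}, 1, by simpa using hβ.symm, by simp⟩

/-- Some shift `log k` is not a period of `exp (β x)` when `β ≠ 0`. -/
lemma exists_natCast_cpow_ne_one {β : ℂ} (hβ : β ≠ 0) : ∃ k : ℕ, 0 < k ∧ (k : ℂ) ^ β ≠ 1 := by
  by_contra! h
  -- Quotients of consecutive integers give nonzero arguments tending to `0` at which `exp` equals
  -- `1`, although `0` is an isolated solution of `exp w = 1`.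
  have h1 : ∀ k : ℕ, 0 < k → Complex.exp (β * (Real.log (1 + 1 / k) : ℝ)) = 1 := by
    intro k hk
    have hk' : (0 : ℝ) < k := by exact_mod_cast hk
    have e : (1 : ℝ) + 1 / k = ((k + 1 : ℕ) : ℝ) / k := by
      push_cast
      field_simp
    have a := h k hk
    have b := h (k + 1) k.succ_pos
    rw [Complex.cpow_def_of_ne_zero (by exact_mod_cast hk.ne'), ← Complex.natCast_log] at a
    rw [Complex.cpow_def_of_ne_zero (by exact_mod_cast k.succ_ne_zero),
      ← Complex.natCast_log] at b
    rw [e, Real.log_div (by positivity) hk'.ne', Complex.ofReal_sub, mul_sub, Complex.exp_sub,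
      mul_comm β, mul_comm β, a, b, div_one]
  have lim : Tendsto (fun k : ℕ => β * ((Real.log (1 + 1 / k) : ℝ) : ℂ)) atTop (𝓝 0) := by
    have t1 : Tendsto (fun k : ℕ => (1 : ℝ) + 1 / k) atTop (𝓝 1) := by
      simpa using tendsto_const_nhds.add (tendsto_one_div_atTop_nhds_zero_nat (𝕜 := ℝ))
    have t2 := ((Real.continuousAt_log one_ne_zero).tendsto.comp t1).ofReal
    simpa using t2.const_mul β
  have ev : ∀ᶠ w in 𝓝 (0 : ℂ), Complex.exp w = 1 → w = 0 := by
    have := (Complex.hasDerivAt_exp 0).eventually_ne (c := 1) (by simp)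
    rw [eventually_nhdsWithin_iff] at this
    filter_upwards [this] with w hw hw1
    by_contra h0
    exact hw h0 hw1
  obtain ⟨k, hk, hk0⟩ := ((lim.eventually ev).and (eventually_gt_atTop 0)).exists
  have h2 := hk (h1 k hk0)
  have hk' : (0 : ℝ) < k := by exact_mod_cast hk0
  have h3 : 0 < Real.log (1 + 1 / k) := Real.log_pos (by simpa using hk')
  rcases mul_eq_zero.1 h2 with h4 | h4
  · exact hβ h4
  · exact h3.ne' (by exact_mod_cast h4)

open Polynomial in
/-- Translation `p(X) ↦ p(X + a)`, the difference of `r p(X + a)` and `q p(X)`. -/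
noncomputable def twistedDiff (r q a : ℂ) (p : ℂ[X]) : ℂ[X] :=
  C r * p.comp (X + C a) - C q * p

open Polynomial in
-- Translation preserves the leading coefficient. So the degree drops if `r = q`, and the top
-- coefficient of `p` can be recovered if `r ≠ q`.
lemma coeff_twistedDiff (r q a : ℂ) (p : ℂ[X]) :
    (twistedDiff r q a p).coeff p.natDegree = (r - q) * p.leadingCoeff := by
  have h : (p.comp (X + C a)).coeff p.natDegree = p.leadingCoeff := by
    have := leadingCoeff_taylor (f := p) (r := a)
    rw [leadingCoeff, natDegree_taylor, taylor_apply] at this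
    exact this
  rw [twistedDiff, coeff_sub, coeff_C_mul, coeff_C_mul, h, coeff_natDegree]
  ring

open Polynomial in
lemma eq_C_of_tendsto_eval {p : ℂ[X]} {c : ℂ} {x : ℕ → ℂ}
    (hx : Tendsto (fun N => ‖x N‖) atTop atTop)
    (h : Tendsto (fun N => p.eval (x N)) atTop (𝓝 c)) : p = C c := by
  by_cases hd : 0 < p.degree
  · exact absurd (p.tendsto_norm_atTop hd hx) (not_tendsto_atTop_of_tendsto_nhds h.norm)
  · have hp := eq_C_of_degree_le_zero (not_lt.1 hd)
    rw [hp] at h ⊢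
    simp only [eval_C] at h
    rw [tendsto_nhds_unique tendsto_const_nhds h]

open Polynomial in
/-- Asymptotic independence of the functions `N ^ β (log N) ^ l`. -/
lemma eq_C_of_tendsto_expPoly (B : Finset ℂ) (hB : (0 : ℂ) ∉ B) (p : ℂ → ℂ[X]) (c : ℂ)
    (h : Tendsto (fun N : ℕ => (p 0).eval (Real.log N : ℂ) +
      ∑ β ∈ B, (N : ℂ) ^ β * (p β).eval (Real.log N : ℂ)) atTop (𝓝 c)) : p 0 = C c := by
  classical
  have hlog : Tendsto (fun N : ℕ => ‖((Real.log N : ℝ) : ℂ)‖) atTop atTop := by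
    simp only [Complex.norm_real]
    exact tendsto_norm_atTop_atTop.comp (Real.tendsto_log_atTop.comp tendsto_natCast_atTop_atTop)
  -- The outer induction removes the exponents one at a time, the inner one bounds the degree of `p
  -- β`. The operator `f(N) ↦ f(k N) - k ^ β f(N)` preserves the shape of the sum and lowers the
  -- degree of `p β`, while it multiplies the top coefficient of `p 0` by `1 - k ^ β ≠ 0`.
  induction B using Finset.induction_on generalizing p c with
  | empty => exact eq_C_of_tendsto_eval hlog (by simpa using h)
  | insert β B hβB ih =>
    have hβ : β ≠ 0 := by
      rintro rfl
      simp at hB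
    have hB' : (0 : ℂ) ∉ B := fun h0 => hB (by simp [h0])
    obtain ⟨k, hk0, hk⟩ := exists_natCast_cpow_ne_one hβ
    have hkC : (k : ℂ) ≠ 0 := by exact_mod_cast hk0.ne'
    obtain ⟨n, hn⟩ : ∃ n, (p β).degree < (n : ℕ) := ⟨(p β).natDegree + 1, by
      refine degree_le_natDegree.trans_lt ?_
      exact_mod_cast Nat.lt_succ_self _⟩
    induction n generalizing p c with
    | zero =>
      have : p β = 0 := by
        rw [← degree_eq_bot]
        exact Nat.WithBot.lt_zero_iff.1 (by simpa using hn)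
      refine ih hB' p c (h.congr fun N => ?_)
      rw [Finset.sum_insert hβB, this]
      simp
    | succ n ihn =>
      let q : ℂ → ℂ[X] := fun b => twistedDiff ((k : ℂ) ^ b) ((k : ℂ) ^ β) (Real.log k : ℂ) (p b)
      have hq : q 0 = C (c - (k : ℂ) ^ β * c) := by
        refine ihn q _ ?_ ?_
        · have hmul : Tendsto (fun N : ℕ => k * N) atTop atTop :=
            tendsto_id.const_mul_atTop' hk0
          refine ((h.comp hmul).sub (h.const_mul ((k : ℂ) ^ β))).congr' ?_
          filter_upwards [eventually_gt_atTop 0] with N hN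
          have hl : Real.log ((k * N : ℕ) : ℝ) = Real.log N + Real.log k := by
            push_cast
            rw [Real.log_mul (by positivity) (by positivity), add_comm]
          have key : ∀ b, ((k * N : ℕ) : ℂ) ^ b * (p b).eval (Real.log ((k * N : ℕ) : ℝ) : ℂ) -
              (k : ℂ) ^ β * ((N : ℂ) ^ b * (p b).eval (Real.log N : ℂ)) =
              (N : ℂ) ^ b * (q b).eval (Real.log N : ℂ) := by
            intro b
            rw [hl, Nat.cast_mul, Complex.natCast_mul_natCast_cpow]
            simp only [q, twistedDiff, eval_sub, eval_mul, eval_C, eval_comp, eval_add, eval_X]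
            push_cast
            ring
          have key0 := key 0
          simp only [Complex.cpow_zero, one_mul] at key0
          rw [← key0, ← Finset.sum_congr rfl fun b _ => key b, Finset.sum_sub_distrib,
            ← Finset.mul_sum]
          simp only [Function.comp]
          ring
        · by_cases h0 : p β = 0
          · simp [q, h0, twistedDiff]
          have hdeg : (taylor (Real.log k : ℂ) (p β) - p β).degree < (p β).degree := by
            have := degree_sub_lt_left (degree_taylor (p β) (Real.log k : ℂ))
              (by rwa [Ne, taylor_eq_zero]) (leadingCoeff_taylor _ _)
            rwa [degree_taylor] at this
          have hq : q β = C ((k : ℂ) ^ β) * (taylor (Real.log k : ℂ) (p β) - p β) := by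
            simp only [q, twistedDiff, taylor_apply]
            ring
          rw [hq]
          rw [degree_C_mul (by simp [Complex.cpow_eq_zero_iff, hkC])]
          rw [degree_eq_natDegree h0] at hdeg hn
          exact hdeg.trans_le (by exact_mod_cast Nat.lt_succ_iff.1 (by exact_mod_cast hn))
      -- As `q 0` is constant, a `p 0` of positive degree would have leading coefficient zero; in
      -- degree zero, division by `1 - k ^ β` returns `c`.
      have hlc := coeff_twistedDiff ((k : ℂ) ^ (0 : ℂ)) ((k : ℂ) ^ β) (Real.log k : ℂ) (p 0)
      have hk' : (1 : ℂ) - (k : ℂ) ^ β ≠ 0 := sub_ne_zero.2 hk.symm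
      change (q 0).coeff _ = _ at hlc
      rw [hq, Complex.cpow_zero, coeff_C] at hlc
      by_cases hd : (p 0).natDegree = 0
      · rw [if_pos hd] at hlc
        have hpc := eq_C_of_natDegree_eq_zero hd
        rw [leadingCoeff, hd] at hlc
        rw [hpc]
        congr 1
        refine mul_left_cancel₀ hk' ?_
        rw [← hlc]
        ring
      · rw [if_neg hd] at hlc
        have := (mul_eq_zero.1 hlc.symm).resolve_left hk'
        rw [leadingCoeff_eq_zero] at this
        simp [this] at hd

/-- The finite part is unique. -/
theorem HasFinitePart.unique {f : ℕ → ℂ} {C D : ℂ} (hC : HasFinitePart f C)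
    (hD : HasFinitePart f D) : C = D := by
  classical
  have h := hC.add (hD.const_mul (-1))
  have h' : HasFinitePart 0 (C - D) := by
    have := h.congr' (g := 0) (Eventually.of_forall fun N => by simp)
    simpa [sub_eq_add_neg] using this
  obtain ⟨c, hc0, hc⟩ := hasFinitePart_iff.1 h'
  -- Terms are grouped by exponent into polynomials in `log N`. Since `c (0, 0) = 0`, the polynomial
  -- for exponent `0` has no constant term, yet it must be the constant `C - D`.
  let p : ℂ → Polynomial ℂ := fun b =>
    ∑ e ∈ c.support with e.1 = b, Polynomial.monomial e.2 (-(c e))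
  let S : Finset ℂ := insert 0 (c.support.image Prod.fst)
  have hp : p 0 = Polynomial.C (C - D) := by
    refine eq_C_of_tendsto_expPoly (S.erase 0) (by simp) p _ (hc.congr fun N => ?_)
    have e0 : (p 0).eval (Real.log N : ℂ) = (N : ℂ) ^ (0 : ℂ) * (p 0).eval (Real.log N : ℂ) := by
      simp
    rw [e0, Finset.add_sum_erase S (fun b => (N : ℂ) ^ b * (p b).eval (Real.log N : ℂ))
      (by simp [S])]
    simp only [p, Polynomial.eval_finsetSum, Polynomial.eval_monomial, Finset.mul_sum]
    have := Finset.sum_fiberwise_of_maps_to (s := c.support) (t := S) (g := Prod.fst)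
      (fun e he => Finset.mem_insert_of_mem (Finset.mem_image_of_mem _ he))
      (fun e => (N : ℂ) ^ e.1 * (-c e * (Real.log N : ℂ) ^ e.2))
    rw [powerLog, Finsupp.sum, Pi.zero_apply, zero_sub, ← Finset.sum_neg_distrib]
    refine Eq.trans ?_ (this.symm.trans ?_)
    · exact Finset.sum_congr rfl fun e _ => by ring
    · refine Finset.sum_congr rfl fun b _ => Finset.sum_congr rfl fun e he => ?_
      rw [(Finset.mem_filter.1 he).2]
  have h0 := congrArg (fun r => r.coeff 0) hp
  simp only [p, Polynomial.finsetSum_coeff, Polynomial.coeff_monomial, Polynomial.coeff_C_zero]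
    at h0
  rw [Finset.sum_eq_zero] at h0
  · exact sub_eq_zero.1 h0.symm
  · intro e he
    have he1 := (Finset.mem_filter.1 he).2
    split_ifs with he2
    · rw [show e = (0, 0) from Prod.ext he1 he2, hc0, neg_zero]
    · rfl

lemma HasFinitePart.finitePart_eq {f : ℕ → ℂ} {C : ℂ} (h : HasFinitePart f C) :
    finitePart f = C := by
  have h' : ∃ C, HasFinitePart f C := ⟨C, h⟩
  rw [finitePart, dif_pos h']
  exact h'.choose_spec.unique h

/-! ### Euler–Maclaurin summation of `x ^ (-s)` -/

/-- `1 - s` times the coefficient of `x ^ (1 - s - j)` in the Euler–Maclaurin expansion. -/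
noncomputable def emCoeff (j : ℕ) (s : ℂ) : ℂ :=
  (bernoulli j : ℂ) / j.factorial * ∏ i ∈ Finset.range j, (1 - s - i)

/-- The Euler–Maclaurin expansion to order `M`, multiplied by `1 - s`. -/
noncomputable def emPoly (M : ℕ) (x : ℝ) (s : ℂ) : ℂ :=
  ∑ j ∈ Finset.range M, emCoeff j s * (x : ℂ) ^ (1 - s - j)

/-- The error of the Euler–Maclaurin expansion as a discrete primitive of `(1 - s) x ^ (-s)`. -/
noncomputable def emErr (M : ℕ) (x : ℝ) (s : ℂ) : ℂ :=
  emPoly M (x + 1) s - emPoly M x s - (1 - s) * (x : ℂ) ^ (-s)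

/-- The two falling products concatenate, so apart from the numerical factor only `j + k` matters.
This lets the double sum be collected along antidiagonals. -/
lemma emCoeff_mul_binom (j k : ℕ) (s : ℂ) :
    emCoeff j s * binom (1 - s - j) k = (bernoulli j : ℂ) / (j.factorial * k.factorial) *
      ∏ i ∈ Finset.range (j + k), (1 - s - i) := by
  rw [emCoeff, binom, Finset.prod_range_add]
  have : ∏ i ∈ Finset.range k, (1 - s - ((j + i : ℕ) : ℂ)) =
      ∏ i ∈ Finset.range k, (1 - s - j - i) :=
    Finset.prod_congr rfl fun i _ => by push_cast; ring
  rw [this]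
  field_simp

/-- These are the coefficients of `(D / (e ^ D - 1)) * ((e ^ D - 1) / D) = 1`. -/
lemma sum_bernoulli_div_factorial (m : ℕ) :
    ∑ j ∈ Finset.range (m + 1), (bernoulli j : ℂ) / (j.factorial * (m - j + 1).factorial) =
      if m = 0 then 1 else 0 := by
  have h := congrArg (fun q : ℚ => (q : ℂ)) (sum_bernoulli (m + 1))
  have hf : ((m + 1).factorial : ℂ) ≠ 0 := by exact_mod_cast (m + 1).factorial_ne_zero
  refine mul_left_cancel₀ hf ?_
  rw [Finset.mul_sum]
  trans (((∑ k ∈ Finset.range (m + 1), ((m + 1).choose k : ℚ) * bernoulli k : ℚ)) : ℂ)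
  · push_cast
    refine Finset.sum_congr rfl fun j hj => ?_
    have hj' : j ≤ m := Nat.lt_succ_iff.1 (Finset.mem_range.1 hj)
    have h1 := Nat.choose_mul_factorial_mul_factorial (n := m + 1) (k := j) (by omega)
    rw [show m + 1 - j = m - j + 1 by omega] at h1
    have h2 : (((m + 1).choose j : ℕ) : ℂ) * j.factorial * (m - j + 1).factorial =
      (m + 1).factorial := by exact_mod_cast h1
    have h3 : (j.factorial : ℂ) ≠ 0 := by exact_mod_cast j.factorial_ne_zero
    have h4 : ((m - j + 1).factorial : ℂ) ≠ 0 := by exact_mod_cast (m - j + 1).factorial_ne_zero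
    rw [← h2]
    field_simp
  · rw [h]
    by_cases hm : m = 0 <;> simp [hm]

/-- With `D = d/dx`, `emPoly` is a truncation of `D / (e ^ D - 1)` applied to `x ^ (1 - s)`.
Applying `e ^ D - 1`, the unit difference, leaves `D x ^ (1 - s)`, and all other orders below the
truncation cancel. -/
lemma sum_emCoeff_mul_binom {M : ℕ} (hM : 0 < M) {x : ℝ} (s : ℂ) :
    ∑ j ∈ Finset.range M, ∑ k ∈ Finset.range (M - j),
      emCoeff j s * (binom (1 - s - j) (k + 1) * (x : ℂ) ^ (1 - s - j - (k + 1 : ℕ))) =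
      (1 - s) * (x : ℂ) ^ (-s) := by
  rw [← Finset.sum_range_diag_flip M fun j k =>
    emCoeff j s * (binom (1 - s - j) (k + 1) * (x : ℂ) ^ (1 - s - j - (k + 1 : ℕ)))]
  have h : ∀ m ∈ Finset.range M, ∑ j ∈ Finset.range (m + 1),
      emCoeff j s * (binom (1 - s - j) (m - j + 1) *
        (x : ℂ) ^ (1 - s - j - (m - j + 1 : ℕ))) =
      if m = 0 then (1 - s) * (x : ℂ) ^ (-s) else 0 := by
    intro m _
    trans (∑ j ∈ Finset.range (m + 1), (bernoulli j : ℂ) / (j.factorial * (m - j + 1).factorial)) *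
      ((∏ i ∈ Finset.range (m + 1), (1 - s - i)) * (x : ℂ) ^ (-s - m))
    · rw [Finset.sum_mul]
      refine Finset.sum_congr rfl fun j hj => ?_
      have hj' : j ≤ m := Nat.lt_succ_iff.1 (Finset.mem_range.1 hj)
      rw [← mul_assoc, emCoeff_mul_binom, show j + (m - j + 1) = m + 1 by omega,
        show 1 - s - (j : ℂ) - ((m - j + 1 : ℕ) : ℂ) = -s - m by
          push_cast [Nat.cast_sub hj']; ring]
      ring
    · rw [sum_bernoulli_div_factorial]
      split_ifs with h0
      · simp [h0]
      · simp
  rw [Finset.sum_congr rfl h, Finset.sum_ite_eq' (Finset.range M) 0]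
  simp [hM]

/-- The `j`-th term is expanded to order `M - j + 1`, so that every remainder has the same size `x ^
(-re s - M)`. -/
lemma emErr_eq {M : ℕ} (hM : 0 < M) {x : ℝ} (hx : 1 ≤ x) (s : ℂ) :
    emErr M x s = ∑ j ∈ Finset.range M, emCoeff j s *
      ((x : ℂ) ^ (1 - s - j) * binomRem (M - j + 1) (1 - s - j) (1 / x)) := by
  rw [emErr, ← sum_emCoeff_mul_binom hM, emPoly, emPoly, ← Finset.sum_sub_distrib,
    ← Finset.sum_sub_distrib]
  refine Finset.sum_congr rfl fun j _ => ?_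
  rw [cpow_add_eq (c := 1) (by linarith) zero_le_one (1 - s - j) (M - j + 1),
    Finset.sum_range_succ', ← Finset.mul_sum]
  have h0 : binom (1 - s - j) 0 = 1 := by simp [binom]
  simp only [Complex.ofReal_one, one_pow, mul_one, h0, Nat.cast_zero, sub_zero, one_mul]
  ring

lemma differentiable_emCoeff (j : ℕ) : Differentiable ℂ (emCoeff j) := by
  unfold emCoeff
  fun_prop

lemma differentiable_cpow {x : ℝ} (hx : 0 < x) {f : ℂ → ℂ} (hf : Differentiable ℂ f) :
    Differentiable ℂ fun s => (x : ℂ) ^ f s := fun s =>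
  (hf s).const_cpow (Or.inl (by exact_mod_cast hx.ne'))

lemma differentiable_emPoly (M : ℕ) {x : ℝ} (hx : 0 < x) : Differentiable ℂ (emPoly M x) := by
  unfold emPoly
  refine Differentiable.fun_sum fun j _ => (differentiable_emCoeff j).mul ?_
  exact differentiable_cpow hx (by fun_prop)

lemma differentiable_emErr (M : ℕ) {x : ℝ} (hx : 0 < x) : Differentiable ℂ (emErr M x) := by
  unfold emErr
  exact ((differentiable_emPoly M (by linarith)).sub (differentiable_emPoly M hx)).sub
    ((differentiable_id.const_sub 1).mul (differentiable_cpow hx differentiable_id.neg))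

lemma exists_norm_emCoeff_le (j : ℕ) (B : ℝ) :
    ∃ C, 0 ≤ C ∧ ∀ s : ℂ, ‖s‖ ≤ B → ‖emCoeff j s‖ ≤ C := by
  obtain ⟨C, hC⟩ := (isCompact_closedBall (0 : ℂ) B).exists_bound_of_continuousOn
    (differentiable_emCoeff j).continuous.continuousOn
  exact ⟨max C 0, le_max_right _ _, fun s hs => (hC s (by simpa using hs)).trans (le_max_left _ _)⟩

theorem exists_norm_emErr_le {M : ℕ} (hM : 0 < M) (B : ℝ) :
    ∃ C, 0 ≤ C ∧ ∀ s : ℂ, ‖s‖ ≤ B → ∀ x : ℝ, 1 ≤ x →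
      ‖emErr M x s‖ ≤ C * x ^ (-s.re - M) := by
  choose D hD0 hD using fun j => exists_norm_emCoeff_le j B
  choose E hE0 hE using fun j : ℕ => exists_norm_binomRem_le (M - j + 1) (1 + B + j)
  refine ⟨∑ j ∈ Finset.range M, D j * E j, Finset.sum_nonneg fun j _ =>
    mul_nonneg (hD0 j) (hE0 j), fun s hs x hx => ?_⟩
  have hx0 : 0 < x := by linarith
  rw [emErr_eq hM hx, Finset.sum_mul]
  refine norm_sum_le_of_le _ fun j hj => ?_
  have hj' : j < M := Finset.mem_range.1 hj
  have hβ : ‖1 - s - (j : ℂ)‖ ≤ 1 + B + j := by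
    refine (norm_sub_le _ _).trans (add_le_add ((norm_sub_le _ _).trans ?_) (by simp))
    simpa using hs
  have hR := hE j (1 - s - j) hβ (1 / x) ⟨by positivity, (div_le_one hx0).2 hx⟩
  rw [norm_mul, norm_mul, Complex.norm_cpow_eq_rpow_re_of_pos hx0]
  have e : x ^ (-s.re - M) = x ^ (1 - s - (j : ℂ)).re * (1 / x) ^ (M - j + 1) := by
    rw [one_div, inv_pow, ← Real.rpow_natCast, ← Real.rpow_neg hx0.le, ← Real.rpow_add hx0]
    congr 1
    simp [Nat.cast_sub hj'.le]
    ring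
  rw [e, mul_assoc, ← mul_assoc (E j), mul_comm (E j), mul_assoc]
  have hx1 : 0 ≤ x ^ (1 - s - (j : ℂ)).re := by positivity
  exact mul_le_mul (hD j s hs) (mul_le_mul_of_nonneg_left hR hx1) (by positivity) (hD0 j)

/-- The sum `∑_{m ≥ 1} emErr M (m + v) s`. -/
noncomputable def emErrSum (M : ℕ) (v : ℝ) (s : ℂ) : ℂ :=
  ∑' m : ℕ, emErr M (m + 1 + v) s

lemma summable_succ_rpow_neg_two : Summable fun m : ℕ => ((m : ℝ) + 1) ^ (-2 : ℝ) := by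
  have h := (summable_nat_add_iff 1).2 (Real.summable_nat_rpow (p := -2) |>.2 (by norm_num))
  simpa using h

/-- A bound on the terms of `emErrSum`, uniform in `v ≥ 0`. -/
theorem exists_norm_emErr_shift_le {M : ℕ} (hM : 0 < M) (B : ℝ) :
    ∃ C, 0 ≤ C ∧ ∀ s : ℂ, ‖s‖ ≤ B → 2 ≤ s.re + M → ∀ v : ℝ, 0 ≤ v → ∀ m : ℕ,
      ‖emErr M (m + 1 + v) s‖ ≤
        C * (1 + v) ^ (2 - s.re - M) * ((m : ℝ) + 1) ^ (-2 : ℝ) := by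
  obtain ⟨C, hC0, hC⟩ := exists_norm_emErr_le hM B
  refine ⟨C, hC0, fun s hs hs2 v hv m => ?_⟩
  have hm : (0 : ℝ) ≤ m := m.cast_nonneg
  refine (hC s hs _ (by linarith)).trans ?_
  -- The exponent is split: `-2` pays for summability over `m`, the rest for decay in `v`.
  rw [mul_assoc, show -s.re - M = (2 - s.re - M) + (-2 : ℝ) by ring,
    Real.rpow_add (by linarith)]
  refine mul_le_mul_of_nonneg_left ?_ hC0
  have h1 : ((m : ℝ) + 1 + v) ^ (2 - s.re - M) ≤ (1 + v) ^ (2 - s.re - M) :=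
    Real.rpow_le_rpow_of_nonpos (by linarith) (by linarith) (by linarith)
  have h2 : ((m : ℝ) + 1 + v) ^ (-2 : ℝ) ≤ ((m : ℝ) + 1) ^ (-2 : ℝ) :=
    Real.rpow_le_rpow_of_nonpos (by linarith) (by linarith) (by linarith)
  exact mul_le_mul h1 h2 (by positivity) (by positivity)

lemma summable_emErr {M : ℕ} (hM : 0 < M) {v : ℝ} (hv : 0 ≤ v) {s : ℂ} (hs : 2 ≤ s.re + M) :
    Summable fun m : ℕ => emErr M (m + 1 + v) s := by
  obtain ⟨C, -, hC⟩ := exists_norm_emErr_shift_le hM ‖s‖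
  exact Summable.of_norm_bounded (summable_succ_rpow_neg_two.mul_left _)
    (fun m => hC s le_rfl hs v hv m)

/-- The bound is applied with `v + N` in place of `v`, where `emErrSum` is the tail of the series;
hence the need for an explicit rate in `v`. -/
theorem exists_norm_emErrSum_le {M : ℕ} (hM : 0 < M) (B : ℝ) :
    ∃ C, 0 ≤ C ∧ ∀ s : ℂ, ‖s‖ ≤ B → 2 ≤ s.re + M → ∀ v : ℝ, 0 ≤ v →
      ‖emErrSum M v s‖ ≤ C * (1 + v) ^ (2 - s.re - M) := by
  obtain ⟨C, hC0, hC⟩ := exists_norm_emErr_shift_le hM B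
  refine ⟨C * ∑' m : ℕ, ((m : ℝ) + 1) ^ (-2 : ℝ), by positivity, fun s hs hs2 v hv => ?_⟩
  refine (tsum_of_norm_bounded (summable_succ_rpow_neg_two.hasSum.mul_left _)
    (fun m => hC s hs hs2 v hv m)).trans (le_of_eq ?_)
  ring

lemma analyticAt_emErrSum {M : ℕ} (hM : 0 < M) {v : ℝ} (hv : 0 ≤ v) {s : ℂ}
    (hs : 2 < s.re + M) : AnalyticAt ℂ (emErrSum M v) s := by
  let U : Set ℂ := {w | ‖w‖ < ‖s‖ + 1} ∩ {w | 2 < w.re + M}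
  have hU : IsOpen U := (isOpen_lt continuous_norm continuous_const).inter
    (isOpen_lt continuous_const (Complex.continuous_re.add continuous_const))
  obtain ⟨C, hC0, hC⟩ := exists_norm_emErr_shift_le hM (‖s‖ + 1)
  have hd : DifferentiableOn ℂ (emErrSum M v) U := by
    refine Complex.differentiableOn_tsum_of_summable_norm
      (summable_succ_rpow_neg_two.mul_left C) (fun m w _ => ?_) hU fun m w hw => ?_
    · exact (differentiable_emErr M (by positivity) w).differentiableWithinAt
    · refine (hC w hw.1.le hw.2.le v hv m).trans ?_
      have hw2 : 2 < w.re + M := hw.2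
      have : (1 + v) ^ (2 - w.re - M) ≤ 1 :=
        Real.rpow_le_one_of_one_le_of_nonpos (by linarith) (by linarith)
      refine mul_le_mul_of_nonneg_right ?_ (by positivity)
      exact mul_le_of_le_one_right hC0 this
  exact hd.analyticAt (hU.mem_nhds ⟨by simp, hs⟩)

/-- `(1 - s)` times the Hurwitz zeta function `∑_{n ≥ 1} (n + v) ^ (-s)`. -/
noncomputable def zetaNum (M : ℕ) (v : ℝ) (s : ℂ) : ℂ :=
  -emPoly M (1 + v) s - emErrSum M v s

lemma analyticAt_zetaNum {M : ℕ} (hM : 0 < M) {v : ℝ} (hv : 0 ≤ v) {s : ℂ}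
    (hs : 2 < s.re + M) : AnalyticAt ℂ (zetaNum M v) s :=
  ((differentiable_emPoly M (by linarith)).analyticAt s).neg.sub (analyticAt_emErrSum hM hv hs)

/-- The partial sums of the Hurwitz zeta function. -/
noncomputable def hurwitzSum (v : ℝ) (s : ℂ) (N : ℕ) : ℂ :=
  ∑ n ∈ Finset.range N, ((n + 1 + v : ℝ) : ℂ) ^ (-s)

/-- The differences of `emPoly` telescope, and the finite error sum is the full series minus its
tail. The part independent of `N` is `zetaNum`. -/
theorem one_sub_mul_hurwitzSum {M : ℕ} (hM : 0 < M) {v : ℝ} (hv : 0 ≤ v) {s : ℂ}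
    (hs : 2 ≤ s.re + M) (N : ℕ) :
    (1 - s) * hurwitzSum v s N =
      emPoly M (N + 1 + v) s + zetaNum M v s + emErrSum M (v + N) s := by
  have h1 : ∑ n ∈ Finset.range N, emErr M (n + 1 + v) s =
      emPoly M (N + 1 + v) s - emPoly M (1 + v) s - (1 - s) * hurwitzSum v s N := by
    have h := Finset.sum_range_sub (fun n : ℕ => emPoly M (n + 1 + v) s) N
    rw [Nat.cast_zero, zero_add] at h
    rw [← h, hurwitzSum, Finset.mul_sum, ← Finset.sum_sub_distrib]
    refine Finset.sum_congr rfl fun n _ => ?_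
    rw [emErr, Nat.cast_succ, add_right_comm ((n : ℝ) + 1) v 1]
  have h2 := (summable_emErr hM hv hs).sum_add_tsum_nat_add N
  have h3 : ∑' m : ℕ, emErr M ((m + N : ℕ) + 1 + v) s = emErrSum M (v + N) s := by
    refine tsum_congr fun m => ?_
    congr 1
    push_cast
    ring
  rw [h1, h3] at h2
  rw [zetaNum, show emErrSum M v s = ∑' m : ℕ, emErr M (m + 1 + v) s from rfl, ← h2]
  ring

/-! ### Finite parts of single and double Hurwitz sums -/

lemma tendsto_natCast_add_rpow_neg {a : ℝ} (ha : a < 0) (c : ℝ) :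
    Tendsto (fun N : ℕ => ((N : ℝ) + c) ^ a) atTop (𝓝 0) := by
  have h := (tendsto_rpow_neg_atTop (neg_pos.2 ha)).comp
    (tendsto_atTop_add_const_right _ c (tendsto_natCast_atTop_atTop (R := ℝ)))
  simpa [Function.comp_def] using h

/-- The expansion involves only the powers `N ^ (β - k)`, none of them constant when `β` is not a
natural number. For `β = k` the shift would contribute `c ^ k`. -/
lemma hasFinitePart_natCast_add_cpow {c : ℝ} (hc : 0 ≤ c) {β : ℂ} (hβ : ∀ k : ℕ, β ≠ k) :
    HasFinitePart (fun N => (((N : ℝ) + c : ℝ) : ℂ) ^ β) 0 := by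
  obtain ⟨K, hK⟩ := exists_nat_gt β.re
  obtain ⟨C, -, hC⟩ := exists_norm_binomRem_le K ‖β‖
  have h1 : HasFinitePart (fun N : ℕ => ∑ k ∈ Finset.range K,
      binom β k * (c : ℂ) ^ k * (N : ℂ) ^ (β - k)) (∑ k ∈ Finset.range K, 0) :=
    HasFinitePart.sum fun k _ => by
      simpa using (hasFinitePart_natCast_cpow (sub_ne_zero.2 (hβ k))).const_mul
        (binom β k * (c : ℂ) ^ k)
  have hN0 : ∀ᶠ N : ℕ in atTop, 0 < (N : ℝ) ∧ c ≤ N :=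
    (tendsto_natCast_atTop_atTop.eventually_gt_atTop 0).and
      (tendsto_natCast_atTop_atTop.eventually_ge_atTop c)
  have h2 : Tendsto (fun N : ℕ => (N : ℂ) ^ β * binomRem K β (c / N)) atTop (𝓝 0) := by
    have hlim := (tendsto_natCast_add_rpow_neg (sub_neg.2 hK) 0).const_mul (C * c ^ K)
    simp only [add_zero, mul_zero] at hlim
    refine squeeze_zero_norm' ?_ hlim
    filter_upwards [hN0] with N ⟨hN, hcN⟩
    have hb := hC β le_rfl (c / N) ⟨by positivity, (div_le_one hN).2 hcN⟩
    rw [norm_mul, ← Complex.ofReal_natCast, Complex.norm_cpow_eq_rpow_re_of_pos hN]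
    refine (mul_le_mul_of_nonneg_left hb (by positivity)).trans (le_of_eq ?_)
    rw [Real.rpow_sub hN, Real.rpow_natCast, div_pow]
    ring
  have h3 := (h1.add (hasFinitePart_of_tendsto h2)).congr' (g := fun N : ℕ =>
    (((N : ℝ) + c : ℝ) : ℂ) ^ β) (by
      filter_upwards [hN0] with N ⟨hN, _⟩
      rw [cpow_add_eq hN hc β K, Complex.ofReal_natCast])
  simpa using h3

/-- The analytically continued Hurwitz zeta function `∑_{n ≥ 1} (n + v) ^ (-s)`, on the half
plane `2 < re s + M`. -/
noncomputable def zetaCont (M : ℕ) (v : ℝ) (s : ℂ) : ℂ :=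
  zetaNum M v s / (1 - s)

theorem hasFinitePart_hurwitzSum {M : ℕ} (hM : 0 < M) {v : ℝ} (hv : 0 ≤ v) {s : ℂ}
    (hs : 2 < s.re + M) (hs' : ∀ k : ℤ, s ≠ k) :
    HasFinitePart (hurwitzSum v s) (zetaCont M v s) := by
  have h1 : HasFinitePart (fun N : ℕ => emPoly M (N + 1 + v) s) (∑ j ∈ Finset.range M, 0) := by
    unfold emPoly
    refine HasFinitePart.sum fun j _ => ?_
    have h := (hasFinitePart_natCast_add_cpow (c := 1 + v) (by linarith) (β := 1 - s - j)
      fun k hk => hs' (1 - j - k) (by push_cast; linear_combination -hk)).const_mul (emCoeff j s)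
    simpa only [mul_zero, add_assoc] using h
  obtain ⟨C, -, hC⟩ := exists_norm_emErrSum_le hM ‖s‖
  have h2 : Tendsto (fun N : ℕ => emErrSum M (v + N) s) atTop (𝓝 0) := by
    have hlim := (tendsto_natCast_add_rpow_neg (a := 2 - s.re - M) (by linarith)
      (1 + v)).const_mul C
    rw [mul_zero] at hlim
    refine squeeze_zero_norm (fun N => ?_) hlim
    refine (hC s le_rfl hs.le (v + N) (by positivity)).trans (le_of_eq ?_)
    congr 2
    ring
  have hne : 1 - s ≠ 0 := sub_ne_zero.2 fun h => hs' 1 (by simp [← h])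
  have h3 := ((h1.add (hasFinitePart_of_tendsto (tendsto_const_nhds (x := zetaNum M v s)))).add
    (hasFinitePart_of_tendsto h2)).const_mul (1 - s)⁻¹
  have h4 := h3.congr' (g := hurwitzSum v s) (Eventually.of_forall fun N => by
    beta_reduce
    rw [← one_sub_mul_hurwitzSum hM hv hs.le N, inv_mul_cancel_left₀ hne])
  simpa [zetaCont, div_eq_inv_mul] using h4

/-- The strict double Hurwitz sums. -/
noncomputable def hurwitzSum₂ (v : ℝ) (s t : ℂ) (N : ℕ) : ℂ :=
  ∑ n ∈ Finset.range N, ((n + 1 + v : ℝ) : ℂ) ^ (-s) * hurwitzSum v t n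

/-- The convergent part of the double Hurwitz sum. -/
noncomputable def doubleErr (M : ℕ) (v : ℝ) (s t : ℂ) : ℂ :=
  ∑' n : ℕ, ((n + 1 + v : ℝ) : ℂ) ^ (-s) * emErrSum M (v + n) t

/-- The total exponent of `n + 1 + v` is `2 - re s - re t - M`; the bound `4` brings it down to
`-2`. -/
theorem exists_norm_doubleErr_term_le {M : ℕ} (hM : 0 < M) (B : ℝ) :
    ∃ C, 0 ≤ C ∧ ∀ v : ℝ, 0 ≤ v → ∀ s t : ℂ, ‖t‖ ≤ B → 2 ≤ t.re + M → 4 ≤ s.re + t.re + M →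
      ∀ n : ℕ, ‖((n + 1 + v : ℝ) : ℂ) ^ (-s) * emErrSum M (v + n) t‖ ≤
        C * ((n : ℝ) + 1) ^ (-2 : ℝ) := by
  obtain ⟨C, hC0, hC⟩ := exists_norm_emErrSum_le hM B
  refine ⟨C, hC0, fun v hv s t ht ht2 hst n => ?_⟩
  have hn : (0 : ℝ) ≤ n := n.cast_nonneg
  have hx : (0 : ℝ) < n + 1 + v := by linarith
  have hb := hC t ht ht2 (v + n) (by linarith)
  rw [show 1 + (v + (n : ℝ)) = n + 1 + v by ring] at hb
  rw [norm_mul, Complex.norm_cpow_eq_rpow_re_of_pos hx]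
  refine (mul_le_mul_of_nonneg_left hb (by positivity)).trans ?_
  rw [mul_left_comm, ← Real.rpow_add hx]
  refine mul_le_mul_of_nonneg_left ?_ hC0
  calc ((n : ℝ) + 1 + v) ^ ((-s).re + (2 - t.re - M)) ≤ ((n : ℝ) + 1 + v) ^ (-2 : ℝ) :=
        Real.rpow_le_rpow_of_exponent_le (by linarith) (by rw [Complex.neg_re]; linarith)
    _ ≤ ((n : ℝ) + 1) ^ (-2 : ℝ) :=
        Real.rpow_le_rpow_of_nonpos (by linarith) (by linarith) (by linarith)

lemma tendsto_doubleErr {M : ℕ} (hM : 0 < M) {v : ℝ} (hv : 0 ≤ v) {s t : ℂ}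
    (ht : 2 ≤ t.re + M) (hst : 4 ≤ s.re + t.re + M) :
    Tendsto (fun N => ∑ n ∈ Finset.range N,
      ((n + 1 + v : ℝ) : ℂ) ^ (-s) * emErrSum M (v + n) t) atTop (𝓝 (doubleErr M v s t)) := by
  obtain ⟨C, -, hC⟩ := exists_norm_doubleErr_term_le hM ‖t‖
  exact (Summable.of_norm_bounded (summable_succ_rpow_neg_two.mul_left C)
    (fun n => hC v hv s t le_rfl ht hst n)).hasSum.tendsto_sum_nat

/-- The formula for the inner sum is inserted. Because the inequalities are strict, its expansion is
in powers of `n + 1 + v`, the base of the outer term, so exponents simply add. -/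
lemma one_sub_mul_hurwitzSum₂ {M : ℕ} (hM : 0 < M) {v : ℝ} (hv : 0 ≤ v) {s t : ℂ}
    (ht : 2 ≤ t.re + M) (N : ℕ) :
    (1 - t) * hurwitzSum₂ v s t N =
      ∑ j ∈ Finset.range M, emCoeff j t * hurwitzSum v (s + t + j - 1) N +
        zetaNum M v t * hurwitzSum v s N +
          ∑ n ∈ Finset.range N, ((n + 1 + v : ℝ) : ℂ) ^ (-s) * emErrSum M (v + n) t := by
  simp only [hurwitzSum₂, hurwitzSum, Finset.mul_sum]
  rw [Finset.sum_comm, ← Finset.sum_add_distrib, ← Finset.sum_add_distrib]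
  refine Finset.sum_congr rfl fun n _ => ?_
  have hx : (((n : ℝ) + 1 + v : ℝ) : ℂ) ≠ 0 := by
    exact_mod_cast (by positivity : (0 : ℝ) < n + 1 + v).ne'
  have h := one_sub_mul_hurwitzSum hM hv ht n
  have h1 : ∑ j ∈ Finset.range M, emCoeff j t *
      ((n + 1 + v : ℝ) : ℂ) ^ (-(s + t + j - 1)) =
      ((n + 1 + v : ℝ) : ℂ) ^ (-s) * emPoly M (n + 1 + v) t := by
    rw [emPoly, Finset.mul_sum]
    refine Finset.sum_congr rfl fun j _ => ?_
    rw [mul_left_comm, ← Complex.cpow_add _ _ hx]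
    congr 2
    ring
  rw [h1, ← Finset.mul_sum, ← Finset.mul_sum]
  change (1 - t) * (_ * hurwitzSum v t n) = _
  linear_combination ((n + 1 + v : ℝ) : ℂ) ^ (-s) * h

/-- The analytically continued double Hurwitz zeta function. -/
noncomputable def zetaCont₂ (M : ℕ) (v : ℝ) (s t : ℂ) : ℂ :=
  (1 - t)⁻¹ * (∑ j ∈ Finset.range M, emCoeff j t * zetaCont M v (s + t + j - 1) +
    zetaNum M v t * zetaCont M v s + doubleErr M v s t)

theorem hasFinitePart_hurwitzSum₂ {M : ℕ} (hM : 0 < M) {v : ℝ} (hv : 0 ≤ v) {s t : ℂ}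
    (hs : 2 < s.re + M) (ht : 2 < t.re + M) (hst : 4 ≤ s.re + t.re + M)
    (hs' : ∀ k : ℤ, s ≠ k) (ht' : t ≠ 1) (hst' : ∀ k : ℤ, s + t ≠ k) :
    HasFinitePart (hurwitzSum₂ v s t) (zetaCont₂ M v s t) := by
  have h1 : HasFinitePart (fun N => ∑ j ∈ Finset.range M,
      emCoeff j t * hurwitzSum v (s + t + j - 1) N)
      (∑ j ∈ Finset.range M, emCoeff j t * zetaCont M v (s + t + j - 1)) := by
    refine HasFinitePart.sum fun j _ => (hasFinitePart_hurwitzSum hM hv ?_ ?_).const_mul _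
    · have : (0 : ℝ) ≤ j := j.cast_nonneg
      simp only [Complex.sub_re, Complex.add_re, Complex.natCast_re, Complex.one_re]
      linarith
    · exact fun k hk => hst' (k - j + 1) (by push_cast; linear_combination hk)
  have h2 := ((h1.add ((hasFinitePart_hurwitzSum hM hv hs hs').const_mul (zetaNum M v t))).add
    (hasFinitePart_of_tendsto (tendsto_doubleErr hM hv ht.le hst))).const_mul (1 - t)⁻¹
  refine h2.congr' (Eventually.of_forall fun N => ?_)
  beta_reduce
  rw [← one_sub_mul_hurwitzSum₂ hM hv ht.le N, inv_mul_cancel_left₀ (sub_ne_zero.2 ht'.symm)]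

/-! ### Regularity along the diagonal -/

lemma exists_eq_mul_of_analyticAt {f : ℂ → ℂ} (hf : AnalyticAt ℂ f 0) (h0 : f 0 = 0) :
    ∃ q : ℂ → ℂ, AnalyticAt ℂ q 0 ∧ ∀ z, f z = z * q z := by
  obtain ⟨p, hp⟩ := hf
  refine ⟨dslope f 0, hp.has_fpower_series_dslope_fslope.analyticAt, fun z => ?_⟩
  have := sub_smul_dslope f 0 z
  simp only [sub_zero, h0, smul_eq_mul] at this
  exact this.symm

/-- The factor of index `i = b + 1` vanishes. This zero compensates the pole of the double zeta
function. -/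
lemma emCoeff_neg_natCast {b j : ℕ} (h : b + 2 ≤ j) : emCoeff j (-(b : ℂ)) = 0 := by
  rw [emCoeff, Finset.prod_eq_zero (i := b + 1) (Finset.mem_range.2 (by omega)), mul_zero]
  push_cast
  ring

lemma analyticAt_zetaCont {M : ℕ} (hM : 0 < M) {v : ℝ} (hv : 0 ≤ v) {s : ℂ}
    (hs : 2 < s.re + M) (hs' : s ≠ 1) : AnalyticAt ℂ (zetaCont M v) s := by
  unfold zetaCont
  exact (analyticAt_zetaNum hM hv hs).div (by fun_prop) (sub_ne_zero.2 hs'.symm)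

/-- At `z = 0` the argument of the zeta function is `j - a - b - 1`, which equals `1` only for `j =
a + b + 2`. That index is at least `b + 2`, so the coefficient vanishes there and absorbs the simple
pole. -/
lemma exists_analyticAt_emCoeff_mul_zetaCont {v : ℝ} (hv : 0 ≤ v) {M a b : ℕ}
    (hM : a + b + 6 ≤ M) (j : ℕ) :
    ∃ g : ℂ → ℂ, AnalyticAt ℂ g 0 ∧ ∀ᶠ z in 𝓝[≠] (0 : ℂ),
      emCoeff j (-b + z) * zetaCont M v (-a + z + (-b + z) + j - 1) = g z := by
  have hM0 : 0 < M := by omega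
  have hM' : (a : ℝ) + b + 6 ≤ M := by exact_mod_cast hM
  have hre : 2 < ((j : ℂ) - a - b - 1).re + M := by
    have : (0 : ℝ) ≤ j := j.cast_nonneg
    simp only [Complex.sub_re, Complex.natCast_re, Complex.one_re]
    linarith
  have hc : AnalyticAt ℂ (fun z => emCoeff j (-b + z)) 0 :=
    ((differentiable_emCoeff j).analyticAt _).comp_of_eq (by fun_prop) rfl
  have hn : AnalyticAt ℂ (fun z : ℂ => zetaNum M v (-a + z + (-b + z) + j - 1)) 0 :=
    (analyticAt_zetaNum hM0 hv hre).comp_of_eq (by fun_prop) (by ring)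
  by_cases hj : j = a + b + 2
  · obtain ⟨q, hq, hqz⟩ := exists_eq_mul_of_analyticAt hc
      (by simpa using emCoeff_neg_natCast (b := b) (j := j) (by omega))
    refine ⟨fun z => -(q z * zetaNum M v (-a + z + (-b + z) + j - 1)) / 2,
      (hq.mul hn).neg.div analyticAt_const two_ne_zero, ?_⟩
    filter_upwards [self_mem_nhdsWithin] with z hz
    have hz0 : z ≠ 0 := hz
    -- Both arguments move by `z`, so the pole is in `2 z`; this factor is specific to the diagonal
    -- direction.
    have e : (1 : ℂ) - (-a + z + (-b + z) + j - 1) = -(2 * z) := by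
      rw [hj]
      push_cast
      ring
    rw [hqz, zetaCont, e]
    field_simp
  · refine ⟨_, hc.mul ((analyticAt_zetaCont hM0 hv hre ?_).comp_of_eq
      (g := zetaCont M v) (f := fun z : ℂ => -a + z + (-b + z) + j - 1) (by fun_prop) (by ring)),
      Eventually.of_forall fun z => rfl⟩
    intro h
    apply hj
    have h' : (j : ℂ) = ((a + b + 2 : ℕ) : ℂ) := by
      push_cast
      linear_combination h
    exact_mod_cast h'

lemma analyticAt_doubleErr {v : ℝ} (hv : 0 ≤ v) {M a b : ℕ} (hM : a + b + 6 ≤ M) :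
    AnalyticAt ℂ (fun z => doubleErr M v (-a + z) (-b + z)) 0 := by
  have hM0 : 0 < M := by omega
  have hM' : (a : ℝ) + b + 6 ≤ M := by exact_mod_cast hM
  have ha : (0 : ℝ) ≤ a := a.cast_nonneg
  have hb : (0 : ℝ) ≤ b := b.cast_nonneg
  have hball : ∀ z ∈ Metric.ball (0 : ℂ) 1, -1 < z.re ∧ ‖z‖ < 1 := by
    intro z hz
    have h1 : ‖z‖ < 1 := by simpa using hz
    exact ⟨by linarith [(abs_le.1 (Complex.abs_re_le_norm z)).1], h1⟩
  obtain ⟨C, -, hC⟩ := exists_norm_doubleErr_term_le hM0 (b + 1)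
  have hd : DifferentiableOn ℂ (fun z => doubleErr M v (-a + z) (-b + z)) (Metric.ball 0 1) := by
    unfold doubleErr
    refine Complex.differentiableOn_tsum_of_summable_norm
      (summable_succ_rpow_neg_two.mul_left C) (fun n z hz => ?_) Metric.isOpen_ball
      fun n z hz => ?_
    · have h1 : DifferentiableAt ℂ (fun z : ℂ => ((n + 1 + v : ℝ) : ℂ) ^ (-(-a + z))) z :=
        differentiable_cpow (by positivity) (by fun_prop) z
      have h2 : DifferentiableAt ℂ (fun z : ℂ => emErrSum M (v + n) (-b + z)) z :=
        ((analyticAt_emErrSum hM0 (by positivity) (s := -b + z) (by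
          simp only [Complex.add_re, Complex.neg_re, Complex.natCast_re]
          linarith [(hball z hz).1])).comp (g := emErrSum M (v + n)) (f := fun z : ℂ => -b + z)
            (by fun_prop)).differentiableAt
      exact (h1.mul h2).differentiableWithinAt
    · obtain ⟨hz1, hz2⟩ := hball z hz
      refine hC v hv _ _ ?_ ?_ ?_ n
      · refine (norm_add_le _ _).trans ?_
        simp only [norm_neg, Complex.norm_natCast]
        linarith
      all_goals
        simp only [Complex.add_re, Complex.neg_re, Complex.natCast_re]
        linarith
  exact hd.analyticAt (Metric.ball_mem_nhds 0 one_pos)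

/-- The double Hurwitz zeta function has a removable singularity at `(-a, -b)` along the
diagonal direction. -/
theorem exists_analyticAt_zetaCont₂ {v : ℝ} (hv : 0 ≤ v) {M a b : ℕ} (hM : a + b + 6 ≤ M) :
    ∃ F : ℂ → ℂ, AnalyticAt ℂ F 0 ∧ ∀ᶠ z in 𝓝[≠] (0 : ℂ),
      zetaCont₂ M v (-a + z) (-b + z) = F z := by
  have hM0 : 0 < M := by omega
  have hM' : (a : ℝ) + b + 6 ≤ M := by exact_mod_cast hM
  have ha : (0 : ℝ) ≤ a := a.cast_nonneg
  have hb : (0 : ℝ) ≤ b := b.cast_nonneg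
  choose g hg hg' using exists_analyticAt_emCoeff_mul_zetaCont hv hM
  have h1 : AnalyticAt ℂ (fun z : ℂ => (1 - (-b + z))⁻¹) 0 := by
    refine AnalyticAt.inv (by fun_prop) ?_
    rw [add_zero, sub_neg_eq_add]
    exact_mod_cast (by omega : 1 + b ≠ 0)
  have h2 : AnalyticAt ℂ (fun z : ℂ => zetaNum M v (-b + z)) 0 :=
    (analyticAt_zetaNum hM0 hv (s := -b) (by simp; linarith)).comp_of_eq (by fun_prop) (by simp)
  have h3 : AnalyticAt ℂ (fun z : ℂ => zetaCont M v (-a + z)) 0 :=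
    (analyticAt_zetaCont hM0 hv (s := -a) (by simp; linarith) (fun h => by
      have := congrArg Complex.re h
      simp at this
      linarith)).comp_of_eq (by fun_prop) (by simp)
  refine ⟨_, h1.mul (((Finset.analyticAt_fun_sum (Finset.range M) fun j _ => hg j).add
    (h2.mul h3)).add (analyticAt_doubleErr hv hM)), ?_⟩
  filter_upwards [(Finset.eventually_all (Finset.range M)).2 fun j _ => hg' j] with z hz
  simp only [zetaCont₂, Pi.mul_apply, Pi.add_apply]
  rw [Finset.sum_congr rfl hz]

/-! ### The twisted regularisation in depths one and two -/

lemma sum_composition_one {α : Type*} [AddCommMonoid α] (f : Composition 1 → α) :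
    ∑ I, f I = f (Composition.ones 1) := by
  have : Fintype.card (Composition 1) = 1 := by simp [composition_card]
  obtain ⟨x, hx⟩ := Fintype.card_eq_one_iff.1 this
  rw [Finset.sum_eq_single (Composition.ones 1) (fun b _ hb => absurd ((hx b).trans (hx _).symm) hb)
    (by simp)]

lemma sum_composition_two {α : Type*} [AddCommMonoid α] (f : Composition 2 → α) :
    ∑ I, f I = f (Composition.ones 2) + f (Composition.single 2 two_pos) := by
  have hne : Composition.ones 2 ≠ Composition.single 2 two_pos := by
    intro h
    have := congrArg Composition.length h
    simp at this
  have hu : (Finset.univ : Finset (Composition 2)) =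
      {Composition.ones 2, Composition.single 2 two_pos} := by
    symm
    rw [← Finset.card_eq_iff_eq_univ, Finset.card_pair hne, composition_card]
    rfl
  rw [hu, Finset.sum_pair hne]

lemma hoffmanExp_single_one (σ : Sym) :
    hoffmanExp (Finsupp.single [σ] 1) = Finsupp.single [σ] 1 := by
  rw [hoffmanExp, Finsupp.linearCombination_single, one_smul]
  refine (sum_composition_one _).trans ?_
  simp [contract, List.splitWrtComposition, Composition.ones, List.splitWrtCompositionAux]

lemma hoffmanLog_single_one (σ : Sym) :
    hoffmanLog (Finsupp.single [σ] 1) = Finsupp.single [σ] 1 := by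
  rw [hoffmanLog, Finsupp.linearCombination_single, one_smul]
  refine (sum_composition_one _).trans ?_
  simp [contract, List.splitWrtComposition, Composition.ones, List.splitWrtCompositionAux,
    Composition.length]

lemma hoffmanExp_single_two (σ τ : Sym) :
    hoffmanExp (Finsupp.single [σ, τ] 1) =
      Finsupp.single [σ, τ] 1 + Finsupp.single [σ * τ] (1 / 2) := by
  rw [hoffmanExp, Finsupp.linearCombination_single, one_smul]
  refine (sum_composition_two _).trans ?_
  simp [contract, List.splitWrtComposition, Composition.ones, Composition.single,
    List.splitWrtCompositionAux]

lemma hoffmanLog_single_two (σ τ : Sym) :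
    hoffmanLog (Finsupp.single [σ, τ] 1) =
      Finsupp.single [σ, τ] 1 + Finsupp.single [σ * τ] (-1 / 2) := by
  rw [hoffmanLog, Finsupp.linearCombination_single, one_smul]
  refine (sum_composition_two _).trans ?_
  simp [contract, List.splitWrtComposition, Composition.ones, Composition.single,
    List.splitWrtCompositionAux, Composition.length, neg_div, Finsupp.single_neg]

lemma single_eq_smul_one (w : List Sym) (c : ℂ) :
    (Finsupp.single w c : Tensors) = c • Finsupp.single w 1 := by
  simp

lemma tensorExt_single (R : Sym → Sym) (w : List Sym) (c : ℂ) :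
    tensorExt R (Finsupp.single w c) = Finsupp.single (w.map R) c := by
  simp [tensorExt, Finsupp.lmapDomain_apply]

lemma twistedReg_single_one (R : Sym → Sym) (σ : Sym) :
    twistedReg R (Finsupp.single [σ] 1) = Finsupp.single [R σ] 1 := by
  simp only [twistedReg, LinearMap.comp_apply, hoffmanLog_single_one, tensorExt_single,
    List.map_cons, List.map_nil, hoffmanExp_single_one]

/-- The coefficient `1/2` is the `1/2!` of `exp`, and `-1/2` comes from `log`. Together they measure
how far `R` is from being multiplicative. -/
lemma twistedReg_single_two (R : Sym → Sym) (σ τ : Sym) :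
    twistedReg R (Finsupp.single [σ, τ] 1) = Finsupp.single [R σ, R τ] 1 +
      Finsupp.single [R σ * R τ] (1 / 2) + Finsupp.single [R (σ * τ)] (-1 / 2) := by
  simp only [twistedReg, LinearMap.comp_apply, hoffmanLog_single_two, map_add, tensorExt_single,
    List.map_cons, List.map_nil, hoffmanExp_single_two]
  rw [single_eq_smul_one [R (σ * τ)], map_smul, hoffmanExp_single_one]

lemma truncatedSum_add (x y : Tensors) (N : ℕ) :
    truncatedSum (x + y) N = truncatedSum x N + truncatedSum y N :=
  Finsupp.sum_add_index' (by simp) (by intros; ring)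

lemma truncatedSum_single (w : List Sym) (c : ℂ) (N : ℕ) :
    truncatedSum (Finsupp.single w c) N = c * nestedSum w N := by
  rw [truncatedSum, Finsupp.sum_single_index (by simp)]

/-! ### Birkhoff factorisation in depths one and two -/

/-- A nonconstant polynomial in `z⁻¹` is unbounded near `0`, and the constant term is excluded.
Hence whatever pole part is chosen in `polePart`, it is zero for a regular germ. -/
lemma IsPolePart.eq_zero {f : ℂ → ℂ} {p : Polynomial ℂ} (hp : IsPolePart f p) {g : ℂ → ℂ}
    (hg : AnalyticAt ℂ g 0) (hfg : ∀ᶠ z in 𝓝[≠] (0 : ℂ), f z = g z) : p = 0 := by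
  obtain ⟨h0, h, hh, hf⟩ := hp
  have ht : Tendsto (fun z : ℂ => p.eval z⁻¹) (𝓝[≠] 0) (𝓝 (g 0 - h 0)) := by
    refine ((hg.continuousAt.sub hh.continuousAt).tendsto.mono_left nhdsWithin_le_nhds).congr' ?_
    filter_upwards [hf, hfg] with z h1 h2
    rw [Pi.sub_apply, ← h2, h1]
    ring
  by_cases hd : 0 < p.degree
  · exact absurd (p.tendsto_norm_atTop hd tendsto_norm_inv_nhdsNE_zero_atTop)
      (not_tendsto_atTop_of_tendsto_nhds ht.norm)
  · rw [Polynomial.eq_C_of_degree_le_zero (not_lt.1 hd), h0, map_zero]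

lemma polePart_eq_zero {f g : ℂ → ℂ} (hg : AnalyticAt ℂ g 0)
    (hfg : ∀ᶠ z in 𝓝[≠] (0 : ℂ), f z = g z) : polePart f = 0 := by
  unfold polePart
  split_ifs with h
  · funext z
    rw [h.choose_spec.eq_zero hg hfg]
    simp
  · rfl

lemma birkhoffMinus_nil (Φ : List Sym → ℂ → ℂ) : birkhoffMinus Φ [] = 1 := by
  rw [birkhoffMinus, if_pos rfl]

lemma birkhoffMinus_single (Φ : List Sym → ℂ → ℂ) (σ : Sym) {g : ℂ → ℂ} (hg : AnalyticAt ℂ g 0)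
    (h : ∀ᶠ z in 𝓝[≠] (0 : ℂ), Φ [σ] z = g z) : birkhoffMinus Φ [σ] = 0 := by
  rw [birkhoffMinus, if_neg (by simp), polePart_eq_zero hg, neg_zero]
  filter_upwards [h] with z hz
  simp [birkhoffMinus_nil, hz]

lemma birkhoffPlus_single (Φ : List Sym → ℂ → ℂ) (σ : Sym) {g : ℂ → ℂ} (hg : AnalyticAt ℂ g 0)
    (h : ∀ᶠ z in 𝓝[≠] (0 : ℂ), Φ [σ] z = g z) : birkhoffPlus Φ [σ] = Φ [σ] := by
  have e : (fun z => ∑ j : Fin [σ].length,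
      birkhoffMinus Φ ([σ].take j) z * Φ ([σ].drop j) z) = Φ [σ] := by
    funext z
    simp [birkhoffMinus_nil]
  rw [birkhoffPlus, if_neg (by simp), e, polePart_eq_zero hg h, sub_zero]

/-- The only proper splitting contributes `Φ₋(σ) Φ(τ) = 0`, and what remains is regular. -/
lemma birkhoffPlus_pair (Φ : List Sym → ℂ → ℂ) (σ τ : Sym) (hσ : birkhoffMinus Φ [σ] = 0)
    {g : ℂ → ℂ} (hg : AnalyticAt ℂ g 0) (h : ∀ᶠ z in 𝓝[≠] (0 : ℂ), Φ [σ, τ] z = g z) :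
    birkhoffPlus Φ [σ, τ] = Φ [σ, τ] := by
  have e : (fun z => ∑ j : Fin [σ, τ].length,
      birkhoffMinus Φ ([σ, τ].take j) z * Φ ([σ, τ].drop j) z) = Φ [σ, τ] := by
    funext z
    refine (Fin.sum_univ_two _).trans ?_
    simp [birkhoffMinus_nil, hσ]
  rw [birkhoffPlus, if_neg (by simp), e, polePart_eq_zero hg h, sub_zero]

/-! ### Nested sums of Hurwitz symbols -/

lemma sum_Icc_one_eq_sum_range {α : Type*} [AddCommMonoid α] (f : ℕ → α) (N : ℕ) :
    ∑ n ∈ Finset.Icc 1 N, f n = ∑ n ∈ Finset.range N, f (n + 1) := by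
  induction N with
  | zero => simp
  | succ N ih => rw [Finset.sum_Icc_succ_top (by omega), ih, Finset.sum_range_succ]

/-- `σ n = (n + v) ^ (-s)` for `n ≥ 1`. -/
def IsHurwitzSym (v : ℝ) (s : ℂ) (σ : Sym) : Prop :=
  ∀ n : ℕ, σ (n + 1) = ((n + 1 + v : ℝ) : ℂ) ^ (-s)

lemma isHurwitzSym_hurwitzSym (v : ℝ) (s : ℂ) : IsHurwitzSym v s (hurwitzSym v s) := fun n => by
  simp [hurwitzSym]

/-- Exponents add, so every symbol produced by the twisted regularisation is again of Hurwitz type;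
its value at `0` never enters the sums. -/
lemma IsHurwitzSym.mul {v : ℝ} (hv : 0 ≤ v) {s t : ℂ} {σ τ : Sym} (hσ : IsHurwitzSym v s σ)
    (hτ : IsHurwitzSym v t τ) : IsHurwitzSym v (s + t) (σ * τ) := fun n => by
  have hx : (((n : ℝ) + 1 + v : ℝ) : ℂ) ≠ 0 := by
    exact_mod_cast (by positivity : (0 : ℝ) < n + 1 + v).ne'
  rw [Pi.mul_apply, hσ, hτ, ← Complex.cpow_add _ _ hx, neg_add]

lemma IsHurwitzSym.riesz {v : ℝ} (hv : 0 ≤ v) {s : ℂ} {σ : Sym} (hσ : IsHurwitzSym v s σ)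
    (γ : ℂ → ℂ) (z : ℂ) : IsHurwitzSym v (s + γ z) (riesz v γ z σ) :=
  hσ.mul hv (τ := fun n => ((n : ℂ) + (v : ℂ)) ^ (-(γ z))) fun n => by simp

lemma IsHurwitzSym.nestedSum_single {v : ℝ} {s : ℂ} {σ : Sym} (hσ : IsHurwitzSym v s σ) :
    nestedSum [σ] = hurwitzSum v s := by
  funext N
  rw [nestedSum, sum_Icc_one_eq_sum_range, hurwitzSum]
  exact Finset.sum_congr rfl fun n _ => by rw [hσ, nestedSum, mul_one]

lemma IsHurwitzSym.nestedSum_pair {v : ℝ} {s t : ℂ} {σ τ : Sym} (hσ : IsHurwitzSym v s σ)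
    (hτ : IsHurwitzSym v t τ) : nestedSum [σ, τ] = hurwitzSum₂ v s t := by
  funext N
  rw [nestedSum, sum_Icc_one_eq_sum_range, hurwitzSum₂]
  refine Finset.sum_congr rfl fun n _ => ?_
  rw [hσ, Nat.add_sub_cancel, hτ.nestedSum_single]

/-! ### Finite parts near nonpositive integers -/

lemma ne_intCast_of_norm_lt_one {z : ℂ} (hz : z ≠ 0) (hz' : ‖z‖ < 1) (k : ℤ) : z ≠ k := by
  rintro rfl
  rw [Complex.norm_intCast] at hz'
  have : |k| < 1 := by exact_mod_cast hz'
  exact hz (by rw [Int.abs_lt_one_iff.1 this, Int.cast_zero])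

lemma re_mem_of_norm_lt {z : ℂ} {r : ℝ} (hz : ‖z‖ < r) : -r < z.re :=
  (abs_lt.1 ((Complex.abs_re_le_norm z).trans_lt hz)).1

lemma hasFinitePart_hurwitzSum_neg {M a : ℕ} (hM : a + 3 ≤ M) {v : ℝ} (hv : 0 ≤ v) {z : ℂ}
    (hz : z ≠ 0) (hz' : ‖z‖ < 1) :
    HasFinitePart (hurwitzSum v (-a + z)) (zetaCont M v (-a + z)) := by
  have hM' : (a : ℝ) + 3 ≤ M := by exact_mod_cast hM
  refine hasFinitePart_hurwitzSum (by omega) hv ?_ fun k hk => ?_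
  · have := re_mem_of_norm_lt hz'
    simp only [Complex.add_re, Complex.neg_re, Complex.natCast_re]
    linarith
  · exact ne_intCast_of_norm_lt_one hz hz' (k + a) (by push_cast; linear_combination hk)

/-- The radius `1 / 2` keeps `2 z`, which appears in the sum of the two arguments, away from nonzero
integers. -/
lemma hasFinitePart_hurwitzSum₂_neg {M a b : ℕ} (hM : a + b + 6 ≤ M) {v : ℝ} (hv : 0 ≤ v) {z : ℂ}
    (hz : z ≠ 0) (hz' : ‖z‖ < 1 / 2) :
    HasFinitePart (hurwitzSum₂ v (-a + z) (-b + z)) (zetaCont₂ M v (-a + z) (-b + z)) := by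
  have hM' : (a : ℝ) + b + 6 ≤ M := by exact_mod_cast hM
  have ha : (0 : ℝ) ≤ a := a.cast_nonneg
  have hb : (0 : ℝ) ≤ b := b.cast_nonneg
  have hre := re_mem_of_norm_lt hz'
  have hz1 : ‖z‖ < 1 := by linarith
  refine hasFinitePart_hurwitzSum₂ (by omega) hv ?_ ?_ ?_ (fun k hk => ?_) (fun hk => ?_)
    fun k hk => ?_
  · simp only [Complex.add_re, Complex.neg_re, Complex.natCast_re]
    linarith
  · simp only [Complex.add_re, Complex.neg_re, Complex.natCast_re]
    linarith
  · simp only [Complex.add_re, Complex.neg_re, Complex.natCast_re]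
    linarith
  · exact ne_intCast_of_norm_lt_one hz hz1 (k + a) (by push_cast; linear_combination hk)
  · exact ne_intCast_of_norm_lt_one hz hz1 (1 + b) (by push_cast; linear_combination hk)
  · refine ne_intCast_of_norm_lt_one (z := 2 * z) (by simpa using hz) ?_ (k + a + b)
      (by push_cast; linear_combination hk)
    rw [norm_mul, Complex.norm_ofNat]
    linarith

lemma analyticAt_zetaCont_neg_add {M a : ℕ} (hM : a + 3 ≤ M) {v : ℝ} (hv : 0 ≤ v) {f : ℂ → ℂ}
    (hf : AnalyticAt ℂ f 0) (hf0 : f 0 = 0) :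
    AnalyticAt ℂ (fun z => zetaCont M v (-a + f z)) 0 := by
  have hM' : (a : ℝ) + 3 ≤ M := by exact_mod_cast hM
  have ha : (0 : ℝ) ≤ a := a.cast_nonneg
  refine (analyticAt_zetaCont (by omega) hv (s := -a) ?_ fun h => ?_).comp_of_eq
    (g := zetaCont M v) (f := fun z => -a + f z) (analyticAt_const.add hf) (by simp [hf0])
  · simp only [Complex.neg_re, Complex.natCast_re]
    linarith
  · have := congrArg Complex.re h
    simp only [Complex.neg_re, Complex.natCast_re, Complex.one_re] at this
    linarith

/-! ### Renormalised and alternative values -/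

lemma eventually_psi_eq {v : ℝ} {γ : ℂ → ℂ} {w : List Sym} {g : ℂ → ℂ}
    (h : ∀ᶠ z in 𝓝[≠] (0 : ℂ), HasFinitePart (truncatedSum (regularised v γ w z)) (g z)) :
    ∀ᶠ z in 𝓝[≠] (0 : ℂ), Psi v γ w z = g z :=
  h.mono fun _ hz => hz.finitePart_eq

lemma renormalisedZetaExists_of_analyticAt {v : ℝ} {γ : ℂ → ℂ} {s : List ℂ} {g : ℂ → ℂ}
    (hg : AnalyticAt ℂ g 0) (h : ∀ᶠ z in 𝓝[≠] (0 : ℂ),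
      HasFinitePart (truncatedSum (regularised v γ (word v s) z)) (g z))
    (hb : birkhoffPlus (Psi v γ) (word v s) = Psi v γ (word v s)) :
    RenormalisedZetaExists v γ s ∧ renormalisedZeta v γ s = g 0 := by
  have he := eventually_psi_eq h
  have hlim : Tendsto (birkhoffPlus (Psi v γ) (word v s)) (𝓝[≠] 0) (𝓝 (g 0)) := by
    rw [hb]
    exact (hg.continuousAt.tendsto.mono_left nhdsWithin_le_nhds).congr'
      (he.mono fun z hz => hz.symm)
  have hval : renormalisedZeta v γ s = g 0 := hlim.limUnder_eq
  refine ⟨⟨?_, hg.meromorphicAt.congr (he.mono fun z hz => hz.symm), hval ▸ hlim⟩, hval⟩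
  filter_upwards [h, he] with z hz hz'
  rwa [hz']

lemma altZetaExists_of_analyticAt {v : ℝ} {s : List ℂ} {g : ℂ → ℂ}
    (hg : AnalyticAt ℂ g 0) (h : ∀ᶠ z in 𝓝[≠] (0 : ℂ),
      HasFinitePart (nestedSum (word v (s.map (· + z)))) (g z)) :
    AltZetaExists v s ∧ altZeta v s = g 0 := by
  have he : ∀ᶠ z in 𝓝[≠] (0 : ℂ), zeta v (s.map (· + z)) = g z := by
    filter_upwards [h] with z hz
    have e : truncatedSum (Finsupp.single (word v (s.map (· + z))) 1) =
        nestedSum (word v (s.map (· + z))) := by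
      funext N
      rw [truncatedSum_single, one_mul]
    rw [zeta, cutoffSum, e]
    exact hz.finitePart_eq
  have hlim : Tendsto (fun z => zeta v (s.map (· + z))) (𝓝[≠] 0) (𝓝 (g 0)) :=
    (hg.continuousAt.tendsto.mono_left nhdsWithin_le_nhds).congr' (he.mono fun z hz => hz.symm)
  have hval : altZeta v s = g 0 := hlim.limUnder_eq
  refine ⟨⟨?_, hval ▸ hlim⟩, hval⟩
  filter_upwards [h, he] with z hz hz'
  rwa [hz']

lemma hasFinitePart_regularised_single {M a : ℕ} (hM : a + 3 ≤ M) {v : ℝ} (hv : 0 ≤ v)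
    {γ : ℂ → ℂ} {z : ℂ} (hz : γ z ≠ 0) (hz' : ‖γ z‖ < 1) :
    HasFinitePart (truncatedSum (regularised v γ [hurwitzSym v (-a)] z))
      (zetaCont M v (-a + γ z)) := by
  refine (hasFinitePart_hurwitzSum_neg hM hv hz hz').congr' (Eventually.of_forall fun N => ?_)
  rw [regularised, twistedReg_single_one, truncatedSum_single, one_mul,
    ((isHurwitzSym_hurwitzSym v (-a)).riesz hv γ z).nestedSum_single]

/-- Regularising both factors before multiplying shifts the exponent by `2 γ z`, regularising the
product only by `γ z`. -/
lemma hasFinitePart_regularised_pair {M a b : ℕ} (hM : a + b + 6 ≤ M) {v : ℝ} (hv : 0 ≤ v)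
    {γ : ℂ → ℂ} {z : ℂ} (hz : γ z ≠ 0) (hz' : ‖γ z‖ < 1 / 2) :
    HasFinitePart (truncatedSum (regularised v γ [hurwitzSym v (-a), hurwitzSym v (-b)] z))
      (zetaCont₂ M v (-a + γ z) (-b + γ z) +
        1 / 2 * zetaCont M v (-(a + b : ℕ) + 2 * γ z) +
          -1 / 2 * zetaCont M v (-(a + b : ℕ) + γ z)) := by
  have h2 : ‖2 * γ z‖ < 1 := by
    rw [norm_mul, Complex.norm_ofNat]
    linarith
  refine (((hasFinitePart_hurwitzSum₂_neg hM hv hz hz').add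
    ((hasFinitePart_hurwitzSum_neg (M := M) (a := a + b) (by omega) hv
      (mul_ne_zero two_ne_zero hz) h2).const_mul (1 / 2))).add
    ((hasFinitePart_hurwitzSum_neg (M := M) (a := a + b) (by omega) hv hz
      (by linarith)).const_mul (-1 / 2))).congr' (Eventually.of_forall fun N => ?_)
  have ha := isHurwitzSym_hurwitzSym v (-a)
  have hb := isHurwitzSym_hurwitzSym v (-b)
  have hra := ha.riesz hv γ z
  have hrb := hb.riesz hv γ z
  rw [regularised, twistedReg_single_two, truncatedSum_add, truncatedSum_add,
    truncatedSum_single, truncatedSum_single, truncatedSum_single, one_mul,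
    hra.nestedSum_pair hrb, (hra.mul hv hrb).nestedSum_single,
    ((ha.mul hv hb).riesz hv γ z).nestedSum_single]
  have e1 : (-(a : ℂ) + γ z + (-b + γ z)) = -(a + b : ℕ) + 2 * γ z := by
    push_cast
    ring
  have e2 : (-(a : ℂ) + -b + γ z) = -(a + b : ℕ) + γ z := by
    push_cast
    ring
  rw [e1, e2]

end HurwitzMZV

theorem mainTheorem11 (v : ℝ) (hv : 0 ≤ v)
    (γ : ℂ → ℂ) (hγ : AnalyticAt ℂ γ 0) (hγ₀ : γ 0 = 0) (hγ₁ : deriv γ 0 = 1) (a₁ a₂ : ℕ) :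
    (HurwitzMZV.RenormalisedZetaExists v γ [-(a₁ : ℂ)] ∧
      HurwitzMZV.AltZetaExists v [-(a₁ : ℂ)] ∧
      HurwitzMZV.renormalisedZeta v γ [-(a₁ : ℂ)] = HurwitzMZV.altZeta v [-(a₁ : ℂ)]) ∧
    (HurwitzMZV.RenormalisedZetaExists v γ [-(a₁ : ℂ), -(a₂ : ℂ)] ∧
      HurwitzMZV.AltZetaExists v [-(a₁ : ℂ), -(a₂ : ℂ)] ∧
      HurwitzMZV.renormalisedZeta v γ [-(a₁ : ℂ), -(a₂ : ℂ)] =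
        HurwitzMZV.altZeta v [-(a₁ : ℂ), -(a₂ : ℂ)]) := by
  open HurwitzMZV in
  -- For `‖z‖ < 1` the real parts of the two arguments sum to more than `-a₁ - a₂ - 2`; adding the
  -- `4` required by the double error series gives `6`.
  obtain ⟨M, hM⟩ : ∃ M, a₁ + a₂ + 6 ≤ M := ⟨_, le_rfl⟩
  have hsmall : ∀ {f : ℂ → ℂ}, ContinuousAt f 0 → f 0 = 0 →
      ∀ᶠ z in 𝓝[≠] (0 : ℂ), ‖f z‖ < 1 / 2 := by
    intro f hf hf0
    have h : ∀ᶠ z in 𝓝 (0 : ℂ), ‖f z‖ < 1 / 2 :=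
      hf.norm.eventually_lt_const (by simp [hf0])
    exact nhdsWithin_le_nhds h
  have hγne : ∀ᶠ z in 𝓝[≠] (0 : ℂ), γ z ≠ 0 :=
    hγ.differentiableAt.hasDerivAt.eventually_ne (by simp [hγ₁])
  have hγlt := hsmall hγ.continuousAt hγ₀
  have hzlt := hsmall continuousAt_id rfl
  have hzne : ∀ᶠ z in 𝓝[≠] (0 : ℂ), z ≠ 0 := self_mem_nhdsWithin
  -- depth one
  have hψ₁ : ∀ᶠ z in 𝓝[≠] (0 : ℂ), HasFinitePart
      (truncatedSum (regularised v γ [hurwitzSym v (-a₁)] z)) (zetaCont M v (-a₁ + γ z)) := by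
    filter_upwards [hγne, hγlt] with z h1 h2
    exact hasFinitePart_regularised_single (by omega) hv h1 (by linarith)
  have hg₁ : AnalyticAt ℂ (fun z => zetaCont M v (-a₁ + γ z)) 0 :=
    analyticAt_zetaCont_neg_add (by omega) hv hγ hγ₀
  have hζ₁ : ∀ᶠ z in 𝓝[≠] (0 : ℂ), HasFinitePart
      (nestedSum (word v ([-(a₁ : ℂ)].map (· + z)))) (zetaCont M v (-a₁ + z)) := by
    filter_upwards [hzne, hzlt] with z h1 h2
    rw [id] at h2
    change HasFinitePart (nestedSum [hurwitzSym v (-a₁ + z)]) _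
    rw [(isHurwitzSym_hurwitzSym v _).nestedSum_single]
    exact hasFinitePart_hurwitzSum_neg (by omega) hv h1 (by linarith)
  obtain ⟨hr₁, hr₁'⟩ := renormalisedZetaExists_of_analyticAt (s := [-(a₁ : ℂ)]) hg₁ hψ₁
    (birkhoffPlus_single _ _ hg₁ (eventually_psi_eq hψ₁))
  obtain ⟨hα₁, hα₁'⟩ := altZetaExists_of_analyticAt
    (analyticAt_zetaCont_neg_add (M := M) (a := a₁) (f := id) (by omega) hv analyticAt_id rfl) hζ₁
  refine ⟨⟨hr₁, hα₁, by rw [hr₁', hα₁', hγ₀]; rfl⟩, ?_⟩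
  -- depth two
  obtain ⟨F, hF, hFz⟩ := exists_analyticAt_zetaCont₂ hv hM
  -- Since `γ'(0) ≠ 0`, `γ` maps punctured neighbourhoods of `0` to punctured ones, so it merely
  -- reparametrises the diagonal.
  have hFγ : ∀ᶠ z in 𝓝[≠] (0 : ℂ), zetaCont₂ M v (-a₁ + γ z) (-a₂ + γ z) = F (γ z) := by
    have ht : Tendsto γ (𝓝[≠] 0) (𝓝[≠] 0) := by
      refine tendsto_nhdsWithin_iff.2 ⟨?_, hγne⟩
      have := hγ.continuousAt.tendsto
      rw [hγ₀] at this
      exact this.mono_left nhdsWithin_le_nhds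
    exact ht.eventually hFz
  have hψ₂ : ∀ᶠ z in 𝓝[≠] (0 : ℂ), HasFinitePart
      (truncatedSum (regularised v γ [hurwitzSym v (-a₁), hurwitzSym v (-a₂)] z))
      (F (γ z) + 1 / 2 * zetaCont M v (-(a₁ + a₂ : ℕ) + 2 * γ z) +
        -1 / 2 * zetaCont M v (-(a₁ + a₂ : ℕ) + γ z)) := by
    filter_upwards [hγne, hγlt, hFγ] with z h1 h2 h3
    rw [← h3]
    exact hasFinitePart_regularised_pair hM hv h1 h2
  have hg₂ : AnalyticAt ℂ (fun z => F (γ z) + 1 / 2 * zetaCont M v (-(a₁ + a₂ : ℕ) + 2 * γ z) +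
      -1 / 2 * zetaCont M v (-(a₁ + a₂ : ℕ) + γ z)) 0 :=
    ((hF.comp_of_eq hγ hγ₀).add (analyticAt_const.mul
      (analyticAt_zetaCont_neg_add (by omega) hv (analyticAt_const.mul hγ) (by simp [hγ₀])))).add
      (analyticAt_const.mul (analyticAt_zetaCont_neg_add (by omega) hv hγ hγ₀))
  have hζ₂ : ∀ᶠ z in 𝓝[≠] (0 : ℂ), HasFinitePart
      (nestedSum (word v ([-(a₁ : ℂ), -(a₂ : ℂ)].map (· + z)))) (F z) := by
    filter_upwards [hzne, hzlt, hFz] with z h1 h2 h3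
    change HasFinitePart (nestedSum [hurwitzSym v (-a₁ + z), hurwitzSym v (-a₂ + z)]) _
    rw [(isHurwitzSym_hurwitzSym v _).nestedSum_pair (isHurwitzSym_hurwitzSym v _), ← h3]
    exact hasFinitePart_hurwitzSum₂_neg hM hv h1 h2
  obtain ⟨hr₂, hr₂'⟩ := renormalisedZetaExists_of_analyticAt (s := [-(a₁ : ℂ), -(a₂ : ℂ)])
    hg₂ hψ₂ (birkhoffPlus_pair _ _ _
      (birkhoffMinus_single _ _ hg₁ (eventually_psi_eq hψ₁)) hg₂ (eventually_psi_eq hψ₂))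
  obtain ⟨hα₂, hα₂'⟩ := altZetaExists_of_analyticAt hF hζ₂
  refine ⟨hr₂, hα₂, ?_⟩
  -- At `γ 0 = 0` the two depth-one corrections are opposite, and only `F 0` is left.
  rw [hr₂', hα₂', hγ₀, mul_zero]
  ring
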